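/- A matroid $N$ is a (single-element) extension of a matroid $M$ if $N\backslash e = M$ for some element $e$ of $N$ that is not a coloop of $N$; extensions are counted with $M$ labelled and with a fixed name $e$, not in the ground set of $M$, for the new element. Let $M(K_{n+1})$ denote the cycle matroid of the complete graph on $n+1$ vertices. Then the number of extensions of $M(K_{n+1})$ is $$2^{\binom{n}{\lfloor n/2\rfloor}(1+o(1))},$$ where $o(1)$ denotes a function of $n$ that tends to $0$ as $n\to\infty$. -/

import Mathlib

namespace CliqueExt

open SimpleGraph

/-- If both `I` and `J` are edge sets of forests and `J` has more edges, then some edge of `J`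
can be added to `I` so that it stays a forest. -/
theorem forest_augment {V : Type*} [Finite V] {I J : Set (Sym2 V)}
    (hId : ∀ e ∈ I, ¬ e.IsDiag) (hJd : ∀ e ∈ J, ¬ e.IsDiag)
    (hI : (fromEdgeSet I).IsAcyclic) (hJ : (fromEdgeSet J).IsAcyclic)
    (hlt : I.ncard < J.ncard) :
    ∃ e ∈ J, e ∉ I ∧ (fromEdgeSet (insert e I)).IsAcyclic := by
  classical
  by_contra! hcon
  have hes : ∀ {S : Set (Sym2 V)}, (∀ e ∈ S, ¬ e.IsDiag) → (fromEdgeSet S).edgeSet = S := by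
    intro S hS
    rw [edgeSet_fromEdgeSet]
    ext e
    constructor
    · exact fun h => h.1
    · exact fun h => ⟨h, fun h' => hS e h h'⟩
  have hne : Nonempty V := by
    by_contra hV
    rw [not_nonempty_iff] at hV
    rw [Set.eq_empty_of_isEmpty J] at hlt
    simp at hlt
  have key : ∀ u v, s(u, v) ∈ J → (fromEdgeSet I).Reachable u v := by
    intro u v huv
    by_cases hmem : s(u, v) ∈ I
    · refine Adj.reachable ?_
      rw [fromEdgeSet_adj]
      exact ⟨hmem, fun h => hId _ hmem (by simpa using h)⟩
    · by_contra hr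
      refine hcon _ huv hmem ?_
      have h := IsAcyclic.sup_edge_of_not_reachable hr hI
      have heq : fromEdgeSet (insert s(u, v) I) = fromEdgeSet I ⊔ edge u v := by
        rw [edge, ← fromEdgeSet_union, Set.union_comm, Set.singleton_union]
      rwa [heq]
  obtain ⟨T, hJT, -, hT⟩ : ∃ T : SimpleGraph V, fromEdgeSet J ≤ T ∧ T ≤ ⊤ ∧ T.IsTree := by
    obtain ⟨T, h1, h2, h3⟩ :=
      (connected_top (V := V)).exists_isTree_le_of_le_of_isAcyclic le_top hJ
    exact ⟨T, h1, h2, h3⟩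
  have hJsub : J ⊆ T.edgeSet := by
    rw [← hes hJd]
    exact edgeSet_mono hJT
  have hXd : ∀ e ∈ I ∪ (T.edgeSet \ J), ¬ e.IsDiag := by
    rintro e (he | he)
    · exact hId e he
    · exact T.not_isDiag_of_mem_edgeSet he.1
  have hadj : ∀ u v, T.Adj u v → (fromEdgeSet (I ∪ (T.edgeSet \ J))).Reachable u v := by
    intro u v huv
    by_cases hmem : s(u, v) ∈ J
    · exact (key u v hmem).mono (fromEdgeSet_mono Set.subset_union_left)
    · refine Adj.reachable ?_
      rw [fromEdgeSet_adj]
      exact ⟨Or.inr ⟨huv, hmem⟩, huv.ne⟩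
  have hconn : (fromEdgeSet (I ∪ (T.edgeSet \ J))).Connected := by
    refine ⟨fun u v => ?_⟩
    obtain ⟨p⟩ := hT.connected.preconnected u v
    induction p with
    | nil => exact Reachable.refl _
    | cons h _ ih => exact (hadj _ _ h).trans ih
  have h1 := hconn.card_vert_le_card_edgeSet_add_one
  have h2 := (isTree_iff_connected_and_card.1 hT).2
  rw [hes hXd] at h1
  rw [Nat.card_coe_set_eq] at h1 h2
  have h3 := Set.ncard_union_le I (T.edgeSet \ J)
  have h4 := Set.ncard_sdiff_add_ncard_of_subset hJsub
  omega

/-- The cycle matroid `M(G)` of a finite simple graph `G`: its ground set is the edge set of `G`,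
and a set of edges is independent if and only if it contains no cycle. -/
def cycleMatroid {V : Type*} [Finite V] (G : SimpleGraph V) : Matroid (Sym2 V) :=
  (IndepMatroid.ofFinite (E := G.edgeSet) (Set.toFinite _)
    (fun I => I ⊆ G.edgeSet ∧ (fromEdgeSet I).IsAcyclic)
    (by simp)
    (fun _ _ hJ hIJ => ⟨hIJ.trans hJ.1, hJ.2.anti (fromEdgeSet_mono hIJ)⟩)
    (fun I J hI hJ hlt => by
      obtain ⟨e, heJ, heI, he⟩ := forest_augment
        (fun e he => G.not_isDiag_of_mem_edgeSet (hI.1 he))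
        (fun e he => G.not_isDiag_of_mem_edgeSet (hJ.1 he)) hI.2 hJ.2 hlt
      exact ⟨e, heJ, heI, Set.insert_subset (hJ.1 heJ) hI.1, he⟩)
    (fun _ hI => hI.1)).matroid

/-- The (single-element) extensions of a matroid `M` on `α`. The elements of `M` are regarded as
elements of `Option α` through `some`, and `none` is the name of the new element `e`. An extension
is a matroid `N` with an element `e` that is not a coloop of `N` such that `N ＼ {e} = M`. -/
def extensions {α : Type*} (M : Matroid α) : Set (Matroid (Option α)) :=
  {N | none ∈ N.E ∧ ¬ N.IsColoop none ∧
    N.delete {none} = M.map some (Option.some_injective α).injOn}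

end CliqueExt

/-
Extensions of a matroid correspond to its modular cuts. A modular cut of `M(K_{n+1})` is determined
by the hyperplanes it contains, and hyperplanes are the complements of edge cuts; so extensions
correspond to families of vertex sets that are closed under complements and under disjoint unions
(when these do not exhaust the vertices). Represent each cut by its side avoiding a fixed root.
Every member of such a family is a disjoint union of minimal members, so the family is determined
by an antichain of subsets of an `n`-set, and Kleitman's theorem bounds the number of antichains by
`2 ^ ((1 + o(1)) * n.choose (n / 2))`. Conversely, any collection of `(n / 2 + 1)`-subsets is an
intersecting antichain, for which closure under disjoint unions is vacuous; this provides
`2 ^ n.choose (n / 2 + 1)` extensions.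

For Kleitman's theorem, count independent sets in the comparability graph of the Boolean lattice by
the container method of Kleitman and Winston. What it needs is that a family in which each member
is comparable to few others is hardly larger than the middle layer, and this follows from the
argument behind the LYM inequality: a random maximal chain is much less likely to contain both of
two comparable nonempty sets than to contain one of them.
-/

namespace CliqueExt

section ModularCut

open Set

variable {α : Type*} {M : Matroid α} {N : Matroid (Option α)} {𝒞 𝒟 : Set (Set α)} {I J X Y : Set α}

/-- A modular cut of `M`, encoded as the family of all sets, not only flats, whose closure belongs
to it. Modularity is only required for two flats that cover their intersection; for matroids of
finite rank this suffices to define an extension. -/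
structure IsModularCut (M : Matroid α) (𝒞 : Set (Set α)) : Prop where
  ground_mem : M.E ∈ 𝒞
  mem_of_closure_subset : ∀ ⦃X Y⦄, X ∈ 𝒞 → M.closure X ⊆ M.closure Y → Y ∈ 𝒞
  mem_of_insert_mem : ∀ ⦃X f g⦄, insert f X ∈ 𝒞 → insert g X ∈ 𝒞 →
    f ∉ M.closure (insert g X) → X ∈ 𝒞

/-- The modular cut of `N ＼ {none}` that corresponds to `N`: the sets spanning the new element. -/
def modularCut (N : Matroid (Option α)) : Set (Set α) :=
  {X | none ∈ N.closure (some '' X)}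

theorem IsModularCut.mem_iff_of_closure_eq (h𝒞 : IsModularCut M 𝒞)
    (hXY : M.closure X = M.closure Y) : X ∈ 𝒞 ↔ Y ∈ 𝒞 :=
  ⟨fun hX => h𝒞.mem_of_closure_subset hX hXY.subset,
    fun hY => h𝒞.mem_of_closure_subset hY hXY.superset⟩

theorem IsModularCut.eq_of_forall_indep (h𝒞 : IsModularCut M 𝒞) (h𝒟 : IsModularCut M 𝒟)
    (h : ∀ I, M.Indep I → (I ∈ 𝒞 ↔ I ∈ 𝒟)) : 𝒞 = 𝒟 := by
  ext X
  obtain ⟨I, hI⟩ := M.exists_isBasis' X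
  rw [← h𝒞.mem_iff_of_closure_eq hI.closure_eq_closure, h I hI.indep,
    h𝒟.mem_iff_of_closure_eq hI.closure_eq_closure]

theorem preimage_some_image_some (I : Set α) : some ⁻¹' (some '' I) = I :=
  preimage_image_eq I (Option.some_injective α)

theorem image_some_preimage_some {J : Set (Option α)} (h : none ∉ J) :
    some '' (some ⁻¹' J) = J := by
  ext (_ | x) <;> simp [h]

theorem insert_none_image_some_preimage_some {J : Set (Option α)} (h : none ∈ J) :
    insert none (some '' (some ⁻¹' J)) = J := by
  ext (_ | x) <;> simp [h]

theorem encard_preimage_some_of_notMem {J : Set (Option α)} (h : none ∉ J) :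
    (some ⁻¹' J).encard = J.encard := by
  rw [← (Option.some_injective α).encard_image, image_some_preimage_some h]

theorem encard_preimage_some_add_one {J : Set (Option α)} (h : none ∈ J) :
    (some ⁻¹' J).encard + 1 = J.encard := by
  rw [← (Option.some_injective α).encard_image, ← encard_insert_of_notMem (a := none) (by simp),
    insert_none_image_some_preimage_some h]

theorem ground_eq_of_mem_extensions (hN : N ∈ extensions M) :
    N.E = insert none (some '' M.E) := by
  have h := congrArg Matroid.E hN.2.2
  rw [Matroid.delete_ground, Matroid.map_ground] at h
  rw [← h, insert_sdiff_singleton, insert_eq_of_mem hN.1]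

theorem indep_image_some_iff (hN : N ∈ extensions M) : N.Indep (some '' I) ↔ M.Indep I := by
  have h : (N.delete {none}).Indep (some '' I) ↔ M.Indep I := by
    rw [hN.2.2, Matroid.map_indep_iff]
    refine ⟨?_, fun hI => ⟨I, hI, rfl⟩⟩
    rintro ⟨I', hI', hII'⟩
    rwa [image_injective.2 (Option.some_injective α) hII']
  rw [← h, Matroid.deleteElem_indep_iff, and_iff_left (by simp)]

theorem some_mem_closure_image_some_iff (hN : N ∈ extensions M) {f : α} :
    some f ∈ N.closure (some '' X) ↔ f ∈ M.closure X := by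
  have h : (N.delete {none}).closure (some '' X) = some '' M.closure X := by
    rw [hN.2.2, Matroid.map_closure_eq, preimage_some_image_some]
  rw [Matroid.delete_closure_eq_of_disjoint _ (by simp)] at h
  simpa using Set.ext_iff.1 h (some f)

theorem closure_image_some_subset (hN : N ∈ extensions M) (h : M.closure X ⊆ M.closure Y) :
    N.closure (some '' X) ⊆ N.closure (some '' Y) := by
  rw [← N.closure_inter_ground (some '' X)]
  refine N.closure_subset_closure_of_subset_closure ?_
  rintro _ ⟨⟨x, hx, rfl⟩, hxN⟩
  exact (some_mem_closure_image_some_iff hN).2 <| h <|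
    (some_mem_closure_image_some_iff hN).1 <| N.mem_closure_of_mem' ⟨x, hx, rfl⟩ hxN

theorem isModularCut_modularCut (hN : N ∈ extensions M) : IsModularCut M (modularCut N) where
  ground_mem := by
    have hspan := (Matroid.isColoop_iff_notMem_closure_compl hN.1).not_left.1 hN.2.1
    have hcompl : N.E \ {none} = some '' M.E := by
      rw [ground_eq_of_mem_extensions hN]; simp
    rwa [hcompl] at hspan
  mem_of_closure_subset _ _ hX hXY := closure_image_some_subset hN hXY hX
  mem_of_insert_mem X f g hf hg hfg := by
    by_contra hX
    refine hfg ((some_mem_closure_image_some_iff hN).1 ?_)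
    simp only [modularCut, mem_ofPred_eq, image_insert_eq] at hf hg hX ⊢
    rw [← Matroid.closure_insert_congr ⟨hg, hX⟩]
    exact (Matroid.closure_exchange ⟨hf, hX⟩).1

theorem insert_none_indep_iff (hN : N ∈ extensions M) :
    N.Indep (insert none (some '' I)) ↔ M.Indep I ∧ I ∉ modularCut N := by
  rw [Matroid.insert_indep_iff, indep_image_some_iff hN]
  simp [hN.1, modularCut]

theorem injOn_modularCut : InjOn modularCut (extensions M) := by
  intro N hN N' hN' h
  refine Matroid.ext_indep ?_ fun J _ => ?_
  · rw [ground_eq_of_mem_extensions hN, ground_eq_of_mem_extensions hN']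
  · by_cases hnone : none ∈ J
    · rw [← insert_none_image_some_preimage_some hnone, insert_none_indep_iff hN,
        insert_none_indep_iff hN', h]
    · rw [← image_some_preimage_some hnone, indep_image_some_iff hN, indep_image_some_iff hN']

theorem closure_eq_closure_of_subset_closure [M.RankFinite] (hI : M.Indep I) (hJ : M.Indep J)
    (hJI : J ⊆ M.closure I) (h : I.encard ≤ J.encard) : M.closure J = M.closure I := by
  have hcl := (M.isRkFinite_set J).closure_eq_closure_of_subset_of_eRk_ge_eRk hJI <| by
    rwa [M.eRk_closure_eq, hI.eRk_eq_encard, hJ.eRk_eq_encard]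
  rwa [M.closure_closure] at hcl

theorem subset_closure_of_forall_not_indep_insert (hI : M.Indep I) (hJ : M.Indep J)
    (h : ∀ f ∈ J, f ∉ I → ¬ M.Indep (insert f I)) : J ⊆ M.closure I := by
  intro f hf
  rw [hI.mem_closure_iff']
  exact ⟨hJ.subset_ground hf, fun hi => by_contra fun hfI => h f hf hfI hi⟩

/- Augmentation in the extension, of the independent set `I ∪ {e}` from the larger `J` or
`J ∪ {e}`. -/
theorem IsModularCut.exists_insert_notMem [M.RankFinite] (h𝒞 : IsModularCut M 𝒞)
    (hI : M.Indep I) (hJ : M.Indep J) (hI𝒞 : I ∉ 𝒞) (hlt : I.encard < J.encard)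
    (hJ𝒞 : J ∈ 𝒞 → I.encard + 1 < J.encard) :
    ∃ f ∈ J, f ∉ I ∧ M.Indep (insert f I) ∧ insert f I ∉ 𝒞 := by
  by_contra! hno
  obtain ⟨f, ⟨hfJ, hfI⟩, hf⟩ := hI.augment hJ hlt
  have hJf : J ⊆ M.closure (insert f I) := by
    refine subset_closure_of_forall_not_indep_insert hf hJ fun g hgJ hg hgf => hI𝒞 ?_
    have hg_indep : M.Indep (insert g I) := hgf.subset (insert_subset_insert (subset_insert f I))
    exact h𝒞.mem_of_insert_mem (hno g hgJ (fun h => hg (mem_insert_of_mem f h)) hg_indep)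
      (hno f hfJ hfI hf) ((hf.notMem_closure_iff_of_notMem hg (hJ.subset_ground hgJ)).2 hgf)
  have hcard : (insert f I).encard = I.encard + 1 := encard_insert_of_notMem hfI
  have hle : (insert f I).encard ≤ J.encard := hcard ▸ Order.add_one_le_of_lt hlt
  have hJ_mem : J ∈ 𝒞 := (h𝒞.mem_iff_of_closure_eq
    (closure_eq_closure_of_subset_closure hf hJ hJf hle)).2 (hno f hfJ hfI hf)
  refine (hJ𝒞 hJ_mem).not_ge ?_
  rw [← hcard, ← hf.eRk_eq_encard, ← M.eRk_closure_eq]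
  exact hJ.encard_le_eRk_of_subset hJf

/-- Independence in the extension of `M` by the modular cut `𝒞`. -/
def ExtensionIndep (M : Matroid α) (𝒞 : Set (Set α)) (J : Set (Option α)) : Prop :=
  M.Indep (some ⁻¹' J) ∧ (none ∈ J → some ⁻¹' J ∉ 𝒞)

theorem extensionIndep_image_some : ExtensionIndep M 𝒞 (some '' I) ↔ M.Indep I := by
  simp [ExtensionIndep, preimage_some_image_some]

theorem extensionIndep_insert_none :
    ExtensionIndep M 𝒞 (insert none (some '' I)) ↔ M.Indep I ∧ I ∉ 𝒞 := by
  have h : some ⁻¹' insert none (some '' I) = I := by ext; simp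
  simp [ExtensionIndep, h]

theorem extensionIndep_insert_some {I : Set (Option α)} {f : α} :
    ExtensionIndep M 𝒞 (insert (some f) I) ↔
      M.Indep (insert f (some ⁻¹' I)) ∧ (none ∈ I → insert f (some ⁻¹' I) ∉ 𝒞) := by
  have h : some ⁻¹' insert (some f) I = insert f (some ⁻¹' I) := by ext; simp
  simp [ExtensionIndep, h]

theorem IsModularCut.extensionIndep_subset (h𝒞 : IsModularCut M 𝒞) {I J : Set (Option α)}
    (hJ : ExtensionIndep M 𝒞 J) (hIJ : I ⊆ J) : ExtensionIndep M 𝒞 I :=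
  ⟨hJ.1.subset (preimage_mono hIJ), fun hI h => hJ.2 (hIJ hI)
    (h𝒞.mem_of_closure_subset h (M.closure_subset_closure (preimage_mono hIJ)))⟩

theorem IsModularCut.extensionIndep_augment [M.RankFinite] (h𝒞 : IsModularCut M 𝒞)
    {I J : Set (Option α)} (hI : ExtensionIndep M 𝒞 I) (hJ : ExtensionIndep M 𝒞 J)
    (hlt : I.encard < J.encard) : ∃ e ∈ J, e ∉ I ∧ ExtensionIndep M 𝒞 (insert e I) := by
  have hlt_of_mem (hnI : none ∈ I) (hnJ : none ∈ J) :
      (some ⁻¹' I).encard < (some ⁻¹' J).encard := by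
    rwa [← encard_preimage_some_add_one hnI, ← encard_preimage_some_add_one hnJ,
      ENat.add_lt_add_iff_right ENat.one_ne_top] at hlt
  have hlt_of_notMem (hnI : none ∈ I) (hnJ : none ∉ J) :
      (some ⁻¹' I).encard + 1 < (some ⁻¹' J).encard := by
    rwa [encard_preimage_some_add_one hnI, encard_preimage_some_of_notMem hnJ]
  by_cases hnI : none ∈ I
  · obtain ⟨f, hfJ, hfI, hf, hf𝒞⟩ := h𝒞.exists_insert_notMem hI.1 hJ.1 (hI.2 hnI)
      (by
        by_cases hnJ : none ∈ J
        · exact hlt_of_mem hnI hnJ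
        · exact lt_of_le_of_lt le_self_add (hlt_of_notMem hnI hnJ))
      (fun hJ𝒞 => hlt_of_notMem hnI fun hnJ => hJ.2 hnJ hJ𝒞)
    exact ⟨some f, hfJ, hfI, extensionIndep_insert_some.2 ⟨hf, fun _ => hf𝒞⟩⟩
  · by_contra! hno
    have hsub : some ⁻¹' J ⊆ M.closure (some ⁻¹' I) :=
      subset_closure_of_forall_not_indep_insert hI.1 hJ.1 fun f hfJ hfI hf =>
        hno (some f) hfJ hfI (extensionIndep_insert_some.2 ⟨hf, fun h => (hnI h).elim⟩)
    rw [← encard_preimage_some_of_notMem hnI] at hlt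
    by_cases hnJ : none ∈ J
    · rw [← encard_preimage_some_add_one hnJ] at hlt
      have hcl := closure_eq_closure_of_subset_closure hI.1 hJ.1 hsub (Order.le_of_lt_add_one hlt)
      refine hno none hnJ hnI ?_
      rw [← image_some_preimage_some hnI, extensionIndep_insert_none]
      exact ⟨hI.1, (h𝒞.mem_iff_of_closure_eq hcl).not.1 (hJ.2 hnJ)⟩
    · rw [← encard_preimage_some_of_notMem hnJ, ← hI.1.eRk_eq_encard, ← M.eRk_closure_eq] at hlt
      exact hlt.not_ge (hJ.1.encard_le_eRk_of_subset hsub)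

/-- The extension of `M` whose new element is spanned by the members of the modular cut `𝒞`. -/
def IsModularCut.extension [M.RankFinite] (h𝒞 : IsModularCut M 𝒞) : Matroid (Option α) :=
  (IndepMatroid.ofBddAugment (insert none (some '' M.E)) (ExtensionIndep M 𝒞)
    (by simp [ExtensionIndep])
    (fun _ _ => h𝒞.extensionIndep_subset)
    (fun _ _ => h𝒞.extensionIndep_augment)
    (by
      obtain ⟨r, hr⟩ := ENat.ne_top_iff_exists.1 (M.eRank_ne_top_iff.2 inferInstance)
      refine ⟨r + 1, fun J hJ => ?_⟩
      rw [Nat.cast_add_one, hr]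
      by_cases hnJ : none ∈ J
      · rw [← encard_preimage_some_add_one hnJ]
        gcongr
        exact hJ.1.encard_le_eRank
      · rw [← encard_preimage_some_of_notMem hnJ]
        exact hJ.1.encard_le_eRank.trans le_self_add)
    (by
      rintro J hJ (_ | x) hx
      · exact mem_insert _ _
      · exact mem_insert_of_mem _ ⟨x, hJ.1.subset_ground hx, rfl⟩)).matroid

theorem IsModularCut.extension_mem_extensions [M.RankFinite] (h𝒞 : IsModularCut M 𝒞) :
    h𝒞.extension ∈ extensions M := by
  refine ⟨mem_insert _ _, fun hcoloop => ?_, ?_⟩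
  · obtain ⟨B, hB⟩ := M.exists_isBase
    have hB_insert : h𝒞.extension.Indep (insert none (some '' B)) :=
      hcoloop.insert_indep_of_indep (extensionIndep_image_some.2 hB.indep)
    refine (extensionIndep_insert_none.1 hB_insert).2
      (h𝒞.mem_of_closure_subset h𝒞.ground_mem ?_)
    rw [hB.closure_eq, M.closure_ground]
  · have hground : insert none (some '' M.E) \ {none} = some '' M.E := by simp
    refine Matroid.ext_indep hground fun J hJ => ?_
    obtain ⟨I, hI, rfl⟩ := subset_image_iff.1 (hJ.trans hground.subset)
    rw [Matroid.map_image_indep_iff hI, Matroid.deleteElem_indep_iff, and_iff_left (by simp)]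
    exact extensionIndep_image_some

theorem IsModularCut.modularCut_extension [M.RankFinite] (h𝒞 : IsModularCut M 𝒞) :
    modularCut h𝒞.extension = 𝒞 := by
  have hN := h𝒞.extension_mem_extensions
  refine (isModularCut_modularCut hN).eq_of_forall_indep h𝒞 fun I hI => ?_
  have h : M.Indep I ∧ I ∉ modularCut h𝒞.extension ↔ M.Indep I ∧ I ∉ 𝒞 :=
    (insert_none_indep_iff hN).symm.trans extensionIndep_insert_none
  simpa only [hI, true_and, not_iff_not] using h

theorem bijOn_modularCut [M.RankFinite] :
    BijOn modularCut (extensions M) {𝒞 | IsModularCut M 𝒞} :=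
  ⟨fun _ => isModularCut_modularCut, injOn_modularCut, fun _ h𝒞 =>
    ⟨h𝒞.extension, h𝒞.extension_mem_extensions, h𝒞.modularCut_extension⟩⟩

end ModularCut

section CliqueMatroid

open Set SimpleGraph

variable {V : Type*} {A B D : Set V} {b c u v : V}

/-- The edge cut of `A`: the pairs with exactly one end in `A`. In the cycle matroid of a complete
graph, the hyperplanes are the complements of the cuts of nonempty proper vertex sets. -/
def cut (A : Set V) : Set (Sym2 V) :=
  {e | ∃ u ∈ A, ∃ v ∉ A, s(u, v) = e}

theorem mk_mem_cut : s(u, v) ∈ cut A ↔ ¬ (u ∈ A ↔ v ∈ A) := by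
  simp only [cut, mem_ofPred_eq, Sym2.eq_iff]
  grind

theorem cut_compl (A : Set V) : cut Aᶜ = cut A := by
  ext ⟨x, y⟩
  simp only [mk_mem_cut, mem_compl_iff, not_iff_not]

theorem cut_inter_subset (A B : Set V) : cut (A ∩ B) ⊆ cut A ∪ cut B := by
  rintro ⟨x, y⟩
  simp only [mem_union, mk_mem_cut, mem_inter_iff]
  tauto

theorem cut_sdiff_subset (A B : Set V) : cut (A \ B) ⊆ cut A ∪ cut B := by
  simpa only [sdiff_eq, cut_compl] using cut_inter_subset A Bᶜ

theorem cut_union_subset (A B : Set V) : cut (A ∪ B) ⊆ cut A ∪ cut B := by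
  simpa only [← compl_union, cut_compl] using cut_inter_subset Aᶜ Bᶜ

theorem cut_subset_edgeSet_top (A : Set V) : cut A ⊆ (⊤ : SimpleGraph V).edgeSet := by
  rintro _ ⟨u, hu, v, hv, rfl⟩
  exact ne_of_mem_of_not_mem hu hv

theorem eq_or_eq_compl_of_cut_subset (h : cut D ⊆ cut A) (hD : D.Nonempty) (hD' : Dᶜ.Nonempty) :
    D = A ∨ D = Aᶜ := by
  have hiff (x y : V) (hxy : x ∈ A ↔ y ∈ A) : x ∈ D ↔ y ∈ D := by
    by_contra hne
    exact mk_mem_cut.1 (h (mk_mem_cut.2 hne)) hxy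
  obtain ⟨d, hd⟩ := hD
  obtain ⟨c, hc⟩ := hD'
  rw [mem_compl_iff] at hc
  by_cases hdA : d ∈ A
  · left; ext x; grind
  · right; ext x; grind

theorem cut_subset_cut_of_subset_union (hD : cut D ⊆ cut A ∪ cut B) (hAB : Disjoint A B)
    (hb : b ∈ B) (hcA : c ∉ A) (hcB : c ∉ B) (hbc : s(b, c) ∉ cut D) : cut D ⊆ cut A := by
  have hiff (x y : V) (hA : x ∈ A ↔ y ∈ A) (hB : x ∈ B ↔ y ∈ B) : x ∈ D ↔ y ∈ D := by
    by_contra hne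
    rcases hD (mk_mem_cut.2 hne) with h | h
    exacts [mk_mem_cut.1 h hA, mk_mem_cut.1 h hB]
  have hdisj (z : V) (hzA : z ∈ A) : z ∉ B := disjoint_left.1 hAB hzA
  have hbD (z : V) (hz : z ∉ A) : z ∈ D ↔ b ∈ D := by
    rw [mk_mem_cut, not_not] at hbc
    by_cases hzB : z ∈ B
    · exact hiff z b (iff_of_false hz fun h => hdisj b h hb) (iff_of_true hzB hb)
    · exact (hiff z c (iff_of_false hz hcA) (iff_of_false hzB hcB)).trans hbc.symm
  rintro ⟨x, y⟩
  rw [mk_mem_cut, mk_mem_cut]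
  refine mt fun hxy => ?_
  by_cases hx : x ∈ A
  · exact hiff x y hxy (iff_of_false (hdisj x hx) (hdisj y (hxy.1 hx)))
  · exact (hbD x hx).trans (hbD y (hxy.not.1 hx)).symm

theorem reachable_iff_forall_disjoint_cut {G : SimpleGraph V} :
    G.Reachable u v ↔ ∀ A, Disjoint G.edgeSet (cut A) → s(u, v) ∉ cut A := by
  simp only [mk_mem_cut, not_not]
  constructor
  · rintro ⟨p⟩ A hA
    induction p with
    | nil => exact Iff.rfl
    | cons h _ ih => exact (not_not.1 <| mk_mem_cut.not.1 <| disjoint_left.1 hA h).trans ih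
  · intro h
    refine (h {w | G.Reachable u w} (disjoint_left.2 ?_)).1 (Reachable.refl u)
    rintro _ he ⟨x, hx, y, hy, rfl⟩
    exact hy (hx.trans (Adj.reachable he))

variable [Finite V]

theorem mk_mem_closure_iff_reachable_of_indep {G : SimpleGraph V} {I : Set (Sym2 V)}
    (hI : (cycleMatroid G).Indep I) :
    s(u, v) ∈ (cycleMatroid G).closure I ↔ G.Adj u v ∧ (fromEdgeSet I).Reachable u v := by
  have hinsert : (cycleMatroid G).Indep (insert s(u, v) I) ↔
      insert s(u, v) I ⊆ G.edgeSet ∧ (fromEdgeSet I ⊔ edge u v).IsAcyclic := by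
    rw [edge, ← fromEdgeSet_union, union_singleton]
    exact Iff.rfl
  have hground : s(u, v) ∈ (cycleMatroid G).E ↔ G.Adj u v := Iff.rfl
  rw [hI.mem_closure_iff', hinsert, hground, isAcyclic_sup_fromEdgeSet_iff, insert_subset_iff,
    fromEdgeSet_adj, mem_edgeSet]
  have hac : (fromEdgeSet I).IsAcyclic := hI.2
  have hsub : I ⊆ G.edgeSet := hI.1
  refine and_congr_right fun huv => ?_
  have hr (h : s(u, v) ∈ I) : (fromEdgeSet I).Reachable u v :=
    Adj.reachable ((fromEdgeSet_adj _).2 ⟨h, huv.ne⟩)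
  have hne : u ≠ v := huv.ne
  tauto

theorem mk_mem_closure_cycleMatroid_iff_reachable {G : SimpleGraph V} {X : Set (Sym2 V)} :
    s(u, v) ∈ (cycleMatroid G).closure X ↔
      G.Adj u v ∧ (fromEdgeSet (X ∩ G.edgeSet)).Reachable u v := by
  obtain ⟨I, hI⟩ := (cycleMatroid G).exists_isBasis' X
  rw [← hI.closure_eq_closure, mk_mem_closure_iff_reachable_of_indep hI.indep]
  refine and_congr_right fun _ => ⟨fun h => h.mono (fromEdgeSet_mono
    (subset_inter hI.subset hI.indep.subset_ground)), ?_⟩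
  simp only [reachable_iff_reflTransGen]
  refine Relation.reflTransGen_closed (fun x y hxy => ?_) u v
  obtain ⟨⟨hX, hG⟩, -⟩ := (fromEdgeSet_adj _).1 hxy
  rw [← reachable_iff_reflTransGen]
  refine ((mk_mem_closure_iff_reachable_of_indep hI.indep).1 ?_).2
  rw [hI.closure_eq_closure]
  exact (cycleMatroid G).mem_closure_of_mem' hX hG

theorem mem_closure_cycleMatroid_iff {G : SimpleGraph V} {X : Set (Sym2 V)} {e : Sym2 V} :
    e ∈ (cycleMatroid G).closure X ↔
      e ∈ G.edgeSet ∧ ∀ A, Disjoint (X ∩ G.edgeSet) (cut A) → e ∉ cut A := by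
  induction e with | h u v => ?_
  rw [mk_mem_closure_cycleMatroid_iff_reachable, reachable_iff_forall_disjoint_cut, mem_edgeSet,
    edgeSet_fromEdgeSet, sdiff_eq_self_iff_disjoint.2]
  exact disjoint_left.2 fun e he heG => G.not_isDiag_of_mem_edgeSet heG.2 he

/-- The cycle matroid of the complete graph on `V`. -/
abbrev cliqueMatroid (V : Type*) [Finite V] : Matroid (Sym2 V) :=
  cycleMatroid (⊤ : SimpleGraph V)

theorem mem_closure_cliqueMatroid_iff {X : Set (Sym2 V)} {e : Sym2 V} :
    e ∈ (cliqueMatroid V).closure X ↔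
      e ∈ (cliqueMatroid V).E ∧ ∀ A, Disjoint X (cut A) → e ∉ cut A := by
  have hdisj (A : Set V) :
      Disjoint (X ∩ (⊤ : SimpleGraph V).edgeSet) (cut A) ↔ Disjoint X (cut A) := by
    rw [disjoint_iff_inter_eq_empty, inter_assoc, inter_eq_right.2 (cut_subset_edgeSet_top A),
      disjoint_iff_inter_eq_empty]
  simp only [mem_closure_cycleMatroid_iff, hdisj]
  exact Iff.rfl

theorem closure_cliqueMatroid_subset_closure_iff {X Y : Set (Sym2 V)} :
    (cliqueMatroid V).closure X ⊆ (cliqueMatroid V).closure Y ↔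
      ∀ A, Disjoint Y (cut A) → Disjoint X (cut A) := by
  constructor
  · refine fun h A hA => disjoint_left.2 fun e heX heA => ?_
    have heY := h (Matroid.mem_closure_of_mem' _ heX (cut_subset_edgeSet_top A heA))
    exact (mem_closure_cliqueMatroid_iff.1 heY).2 A hA heA
  · refine fun h e he => mem_closure_cliqueMatroid_iff.2 ⟨Matroid.mem_ground_of_mem_closure he, ?_⟩
    exact fun A hA => (mem_closure_cliqueMatroid_iff.1 he).2 A (h A hA)

end CliqueMatroid

section CutClass

open Set SimpleGraph

variable {V : Type*} {A B : Set V} {F : Set (Set V)} {𝒞 : Set (Set (Sym2 V))} {u v x y : V}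

/-- A family of nonempty proper vertex sets, seen as sides of cuts, that is closed under complements
and under disjoint unions. These are the linear classes of hyperplanes of the cycle matroid of a
complete graph. -/
structure IsLinearCutClass (F : Set (Set V)) : Prop where
  nonempty : ∀ ⦃A⦄, A ∈ F → A.Nonempty
  compl_mem : ∀ ⦃A⦄, A ∈ F → Aᶜ ∈ F
  union_mem : ∀ ⦃A B⦄, A ∈ F → B ∈ F → Disjoint A B → (A ∪ B)ᶜ.Nonempty → A ∪ B ∈ F

/-- The cuts whose complementary hyperplane belongs to the modular cut `𝒞`. -/
def cutClass (𝒞 : Set (Set (Sym2 V))) : Set (Set V) :=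
  {A | A.Nonempty ∧ Aᶜ.Nonempty ∧ (cut A)ᶜ ∈ 𝒞}

/-- The inverse of `cutClass`: the sets that lie only on hyperplanes from `F`. -/
def spanningCutClass (F : Set (Set V)) : Set (Set (Sym2 V)) :=
  {X | ∀ A, A.Nonempty → Aᶜ.Nonempty → Disjoint X (cut A) → A ∈ F}

theorem IsLinearCutClass.mem_of_insert_mem_spanningCutClass (hF : IsLinearCutClass F)
    {X : Set (Sym2 V)} (hXA : Disjoint X (cut A)) (hXB : Disjoint X (cut B))
    (hu : u ∈ A) (hv : v ∉ A) (hx : x ∈ A) (hy : y ∉ A) (huB : u ∈ B) (hxB : x ∉ B)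
    (huv : insert s(u, v) X ∈ spanningCutClass F) (hxy : insert s(x, y) X ∈ spanningCutClass F) :
    A ∈ F := by
  have hX : Disjoint X (cut A ∪ cut B) := disjoint_union_right.2 ⟨hXA, hXB⟩
  have hinter : A ∩ B ∈ F := by
    refine hxy _ ⟨u, hu, huB⟩ ⟨x, fun h => hxB h.2⟩ (disjoint_insert_left.2 ⟨?_, ?_⟩)
    · simp [mk_mem_cut, hy, hxB]
    · exact hX.mono_right (cut_inter_subset A B)
  have hsdiff : A \ B ∈ F := by
    refine huv _ ⟨x, hx, hxB⟩ ⟨u, fun h => h.2 huB⟩ (disjoint_insert_left.2 ⟨?_, ?_⟩)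
    · simp [mk_mem_cut, hv, huB]
    · exact hX.mono_right (cut_sdiff_subset A B)
  rw [← inter_union_sdiff A B]
  refine hF.union_mem hinter hsdiff disjoint_sdiff_inter.symm ⟨v, ?_⟩
  rwa [inter_union_sdiff]

theorem IsLinearCutClass.cutClass_spanningCutClass (hF : IsLinearCutClass F) :
    cutClass (spanningCutClass F) = F := by
  ext A
  constructor
  · rintro ⟨hA, hA', h⟩
    exact h A hA hA' disjoint_compl_left
  · refine fun hA => ⟨hF.nonempty hA, hF.nonempty (hF.compl_mem hA), fun D hD hD' h => ?_⟩
    rcases eq_or_eq_compl_of_cut_subset (disjoint_compl_left_iff_subset.1 h) hD hD' with rfl | rfl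
    exacts [hA, hF.compl_mem hA]

variable [Finite V]

theorem IsLinearCutClass.isModularCut_spanningCutClass (hF : IsLinearCutClass F) :
    IsModularCut (cliqueMatroid V) (spanningCutClass F) where
  ground_mem := by
    rintro A ⟨a, ha⟩ ⟨b, hb⟩ hA
    have hab : s(a, b) ∈ cut A := ⟨a, ha, b, hb, rfl⟩
    exact (disjoint_left.1 hA (cut_subset_edgeSet_top A hab) hab).elim
  mem_of_closure_subset X Y hX hXY A hA hA' hYA :=
    hX A hA hA' (closure_cliqueMatroid_subset_closure_iff.1 hXY A hYA)
  mem_of_insert_mem X f g hf hg hfg A hA hA' hXA := by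
    by_cases hfA : f ∉ cut A
    · exact hf A hA hA' (disjoint_insert_left.2 ⟨hfA, hXA⟩)
    by_cases hgA : g ∉ cut A
    · exact hg A hA hA' (disjoint_insert_left.2 ⟨hgA, hXA⟩)
    rw [not_not] at hfA hgA
    have hB : ∃ B, Disjoint (insert g X) (cut B) ∧ f ∈ cut B := by
      by_contra! hB
      exact hfg (mem_closure_cliqueMatroid_iff.2 ⟨cut_subset_edgeSet_top A hfA, hB⟩)
    obtain ⟨B, hgB, hfB⟩ := hB
    rw [disjoint_insert_left] at hgB
    obtain ⟨u, hu, v, hv, rfl⟩ := hfA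
    obtain ⟨x, hx, y, hy, rfl⟩ := hgA
    wlog huB : u ∈ B generalizing B
    · exact this Bᶜ (by rwa [cut_compl]) (by rwa [cut_compl]) huB
    rw [mk_mem_cut] at hfB
    rw [mk_mem_cut, not_not] at hgB
    by_cases hxB : x ∈ B
    · have hmem : Aᶜ ∈ F := hF.mem_of_insert_mem_spanningCutClass (by rwa [cut_compl]) hgB.2 hy
        (not_not.2 hx) hv (not_not.2 hu) (hgB.1.1 hxB) (by tauto)
        (by rwa [Sym2.eq_swap]) (by rwa [Sym2.eq_swap])
      exact compl_compl A ▸ hF.compl_mem hmem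
    · exact hF.mem_of_insert_mem_spanningCutClass hXA hgB.2 hu hv hx hy huB hxB hf hg

theorem IsModularCut.isLinearCutClass_cutClass (h𝒞 : IsModularCut (cliqueMatroid V) 𝒞) :
    IsLinearCutClass (cutClass 𝒞) where
  nonempty _ hA := hA.1
  compl_mem A hA := ⟨hA.2.1, by rw [compl_compl]; exact hA.1, by rw [cut_compl]; exact hA.2.2⟩
  union_mem A B hA hB hAB hAB' := by
    refine ⟨hA.1.mono subset_union_left, hAB', ?_⟩
    obtain ⟨a, ha⟩ := hA.1
    obtain ⟨b, hb⟩ := hB.1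
    obtain ⟨c, hc⟩ := hAB'
    rw [mem_compl_iff, mem_union, not_or] at hc
    have hbA : b ∉ A := disjoint_right.1 hAB hb
    set X := (cut A ∪ cut B)ᶜ
    have hXa : insert s(a, c) X ∈ 𝒞 := by
      refine h𝒞.mem_of_closure_subset hB.2.2 (closure_cliqueMatroid_subset_closure_iff.2 ?_)
      intro D hD
      rw [disjoint_insert_left, disjoint_compl_left_iff_subset, union_comm] at hD
      exact disjoint_compl_left_iff_subset.2
        (cut_subset_cut_of_subset_union hD.2 hAB.symm ha hc.2 hc.1 hD.1)
    have hXb : insert s(b, c) X ∈ 𝒞 := by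
      refine h𝒞.mem_of_closure_subset hA.2.2 (closure_cliqueMatroid_subset_closure_iff.2 ?_)
      intro D hD
      rw [disjoint_insert_left, disjoint_compl_left_iff_subset] at hD
      exact disjoint_compl_left_iff_subset.2
        (cut_subset_cut_of_subset_union hD.2 hAB hb hc.1 hc.2 hD.1)
    have hX : X ∈ 𝒞 := by
      refine h𝒞.mem_of_insert_mem hXa hXb fun hac => ?_
      refine (mem_closure_cliqueMatroid_iff.1 hac).2 A (disjoint_insert_left.2 ⟨?_, ?_⟩) ?_
      · simp [mk_mem_cut, hbA, hc.1]
      · exact disjoint_compl_left_iff_subset.2 subset_union_left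
      · simp [mk_mem_cut, ha, hc.1]
    exact h𝒞.mem_of_closure_subset hX (Matroid.closure_subset_closure _
      (compl_subset_compl.2 (cut_union_subset A B)))

theorem IsModularCut.exists_disjoint_cut (h𝒞 : IsModularCut (cliqueMatroid V) 𝒞)
    {X : Set (Sym2 V)} (hX : X ∉ 𝒞) :
    ∃ A : Set V, A.Nonempty ∧ Aᶜ.Nonempty ∧ Disjoint X (cut A) ∧ (cut A)ᶜ ∉ 𝒞 := by
  obtain ⟨Y, hXY, hY⟩ := Finite.exists_le_maximal (p := (· ∉ 𝒞)) hX
  have hinsert (f : Sym2 V) (hf : f ∉ Y) : insert f Y ∈ 𝒞 := by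
    by_contra hf'
    exact hf (hY.le_of_ge hf' (subset_insert f Y) (mem_insert f Y))
  obtain ⟨f, hfE, hf⟩ : ∃ f ∈ (cliqueMatroid V).E, f ∉ (cliqueMatroid V).closure Y := by
    by_contra! hE
    refine hY.prop (h𝒞.mem_of_closure_subset h𝒞.ground_mem ?_)
    rwa [Matroid.closure_ground]
  have hfY : f ∉ Y := fun h => hf (Matroid.mem_closure_of_mem' _ h hfE)
  rw [mem_closure_cliqueMatroid_iff, not_and] at hf
  push Not at hf
  obtain ⟨A, hYA, hfA⟩ := hf hfE
  have hAY : (cut A)ᶜ ⊆ Y := by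
    intro g hgA
    by_contra hgY
    refine hY.prop (h𝒞.mem_of_insert_mem (hinsert f hfY) (hinsert g hgY) fun hfg => ?_)
    exact (mem_closure_cliqueMatroid_iff.1 hfg).2 A (disjoint_insert_left.2 ⟨hgA, hYA⟩) hfA
  obtain ⟨u, hu, v, hv, -⟩ := hfA
  exact ⟨A, ⟨u, hu⟩, ⟨v, hv⟩, hYA.mono_left hXY, fun hA =>
    hY.prop (h𝒞.mem_of_closure_subset hA (Matroid.closure_subset_closure _ hAY))⟩

theorem IsModularCut.spanningCutClass_cutClass (h𝒞 : IsModularCut (cliqueMatroid V) 𝒞) :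
    spanningCutClass (cutClass 𝒞) = 𝒞 := by
  ext X
  constructor
  · intro hX
    by_contra hX𝒞
    obtain ⟨A, hA, hA', hXA, hA𝒞⟩ := h𝒞.exists_disjoint_cut hX𝒞
    exact hA𝒞 (hX A hA hA' hXA).2.2
  · exact fun hX A hA hA' hXA => ⟨hA, hA', h𝒞.mem_of_closure_subset hX
      (Matroid.closure_subset_closure _ (subset_compl_iff_disjoint_right.2 hXA))⟩

theorem bijOn_cutClass :
    BijOn (cutClass (V := V)) {𝒞 | IsModularCut (cliqueMatroid V) 𝒞} {F | IsLinearCutClass F} :=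
  InvOn.bijOn ⟨fun _ h𝒞 => h𝒞.spanningCutClass_cutClass, fun _ hF => hF.cutClass_spanningCutClass⟩
    (fun _ h𝒞 => h𝒞.isLinearCutClass_cutClass) (fun _ hF => hF.isModularCut_spanningCutClass)

theorem ncard_extensions_cliqueMatroid (V : Type*) [Finite V] :
    (extensions (cliqueMatroid V)).ncard = {F : Set (Set V) | IsLinearCutClass F}.ncard :=
  (bijOn_cutClass.comp bijOn_modularCut).ncard_eq

end CutClass

section MinimalMembers

open Set

variable {α : Type*} [GeneralizedBooleanAlgebra α] [WellFoundedLT α] {F G : Set α}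

theorem subset_of_forall_minimal_mem (hbot : ⊥ ∉ F)
    (hsdiff : ∀ ⦃s t⦄, s ∈ F → t ∈ F → s < t → t \ s ∈ F)
    (hsup : ∀ ⦃s t⦄, s ∈ G → t ∈ G → Disjoint s t → s ⊔ t ∈ G)
    (hmin : ∀ ⦃s⦄, Minimal (· ∈ F) s → s ∈ G) : F ⊆ G := by
  intro t
  induction t using WellFoundedLT.induction with | ind t ih => ?_
  intro ht
  obtain ⟨s, hst, hs⟩ := exists_minimal_le_of_wellFoundedLT (· ∈ F) t ht
  rcases hst.eq_or_lt with rfl | hlt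
  · exact hmin hs
  · have hs_ne : s ≠ ⊥ := ne_of_mem_of_not_mem hs.prop hbot
    have hG : t \ s ∈ G := ih _ (sdiff_lt hst hs_ne) (hsdiff hs.prop ht hlt)
    rw [← sup_sdiff_cancel_right hst]
    exact hsup (hmin hs) hG disjoint_sdiff_self_right

end MinimalMembers

section RootedCuts

open Set

variable {V X : Type*} {φ : X → V} {r : V} {A B : Set V} {F G : Set (Set V)} {s t : Finset X}

/-- The sides of the cuts in `F` that are contained in the range of `φ`. The intended `φ` is an
injection that misses exactly one vertex, so that every cut has exactly one such side. -/
def rootedCuts (φ : X → V) (F : Set (Set V)) : Set (Finset X) :=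
  {s | φ '' s ∈ F}

/-- The sides of the cuts that have a side in `T`, where `X` is seen as a part of `V` by `φ`. -/
def cutsOf (φ : X → V) (T : Set (Finset X)) : Set (Set V) :=
  {A | ∃ s ∈ T, A = φ '' s ∨ Aᶜ = φ '' s}

theorem notMem_image_of_range_eq (hr : range φ = {r}ᶜ) (S : Set X) : r ∉ φ '' S :=
  fun h => hr.subset (image_subset_range φ S h) rfl

theorem IsLinearCutClass.sdiff_mem (hF : IsLinearCutClass F) (hA : A ∈ F) (hB : B ∈ F)
    (hAB : A ⊂ B) : B \ A ∈ F := by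
  have hcompl : (A ∪ Bᶜ)ᶜ = B \ A := by
    rw [compl_union, compl_compl, inter_comm, sdiff_eq]
  rw [← hcompl]
  refine hF.compl_mem (hF.union_mem hA (hF.compl_mem hB) ?_ ?_)
  · exact disjoint_compl_right_iff_subset.2 hAB.subset
  · exact hcompl ▸ nonempty_of_ssubset hAB

theorem IsLinearCutClass.empty_notMem_rootedCuts (hF : IsLinearCutClass F) :
    ∅ ∉ rootedCuts φ F := fun h => by
  simpa using hF.nonempty h

theorem IsLinearCutClass.sdiff_mem_rootedCuts [DecidableEq X] (hF : IsLinearCutClass F)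
    (hφ : φ.Injective) (hs : s ∈ rootedCuts φ F) (ht : t ∈ rootedCuts φ F) (hst : s ⊂ t) :
    t \ s ∈ rootedCuts φ F := by
  have himage : φ '' (t \ s : Finset X) = φ '' t \ φ '' s := by
    rw [Finset.coe_sdiff, image_sdiff hφ]
  rw [rootedCuts, mem_ofPred_eq, himage]
  exact hF.sdiff_mem hs ht (hφ.image_strictMono (Finset.coe_ssubset.2 hst))

theorem IsLinearCutClass.union_mem_rootedCuts [DecidableEq X] (hF : IsLinearCutClass F)
    (hφ : φ.Injective) (hr : range φ = {r}ᶜ) (hs : s ∈ rootedCuts φ F) (ht : t ∈ rootedCuts φ F)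
    (hst : Disjoint s t) : s ∪ t ∈ rootedCuts φ F := by
  have himage : φ '' (s ∪ t : Finset X) = φ '' s ∪ φ '' t := by
    rw [Finset.coe_union, image_union]
  rw [rootedCuts, mem_ofPred_eq, himage]
  refine hF.union_mem hs ht ((disjoint_image_iff hφ).2 (Finset.disjoint_coe.2 hst)) ⟨r, ?_⟩
  rw [← himage]
  exact notMem_image_of_range_eq hr _

theorem IsLinearCutClass.rootedCuts_subset_of_minimal (hF : IsLinearCutClass F)
    (hG : IsLinearCutClass G) (hφ : φ.Injective) (hr : range φ = {r}ᶜ)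
    (h : ∀ ⦃s⦄, Minimal (· ∈ rootedCuts φ F) s → Minimal (· ∈ rootedCuts φ G) s) :
    rootedCuts φ F ⊆ rootedCuts φ G := by
  classical
  exact subset_of_forall_minimal_mem hF.empty_notMem_rootedCuts
    (fun _ _ => hF.sdiff_mem_rootedCuts hφ) (fun _ _ => hG.union_mem_rootedCuts hφ hr)
    fun _ hs => (h hs).prop

variable [Finite X]

theorem exists_image_eq_of_notMem (hr : range φ = {r}ᶜ) (hA : r ∉ A) :
    ∃ s : Finset X, φ '' s = A := by
  refine ⟨(toFinite (φ ⁻¹' A)).toFinset, ?_⟩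
  rw [Finite.coe_toFinset, image_preimage_eq_iff, hr]
  exact subset_compl_singleton_iff.2 hA

theorem IsLinearCutClass.subset_of_rootedCuts_subset (hF : IsLinearCutClass F)
    (hG : IsLinearCutClass G) (hr : range φ = {r}ᶜ) (h : rootedCuts φ F ⊆ rootedCuts φ G) :
    F ⊆ G := by
  have hsub {A : Set V} (hA : A ∈ F) (hrA : r ∉ A) : A ∈ G := by
    obtain ⟨s, rfl⟩ := exists_image_eq_of_notMem hr hrA
    exact h hA
  intro A hA
  by_cases hrA : r ∈ A
  · exact compl_compl A ▸ hG.compl_mem (hsub (hF.compl_mem hA) (not_not.2 hrA))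
  · exact hsub hA hrA

theorem ncard_isLinearCutClass_le (hφ : φ.Injective) (hr : range φ = {r}ᶜ) :
    {F : Set (Set V) | IsLinearCutClass F}.ncard ≤
      {𝒜 : Set (Finset X) | IsAntichain (· ⊆ ·) 𝒜}.ncard := by
  classical
  refine ncard_le_ncard_of_injOn (fun F => {s | Minimal (· ∈ rootedCuts φ F) s})
    (fun F _ => setOfPred_minimal_antichain _) fun F hF G hG h => ?_
  have hmin (s : Finset X) :
      Minimal (· ∈ rootedCuts φ F) s ↔ Minimal (· ∈ rootedCuts φ G) s := Set.ext_iff.1 h s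
  apply Subset.antisymm
  · exact hF.subset_of_rootedCuts_subset hG hr
      (hF.rootedCuts_subset_of_minimal hG hφ hr fun s => (hmin s).1)
  · exact hG.subset_of_rootedCuts_subset hF hr
      (hG.rootedCuts_subset_of_minimal hF hφ hr fun s => (hmin s).2)

end RootedCuts

section CutsOf

open Set

variable {V X : Type*} {φ : X → V} {r : V} {T : Set (Finset X)}

theorem isLinearCutClass_cutsOf [DecidableEq X] (hφ : φ.Injective) (hr : range φ = {r}ᶜ)
    (hT : IsAntichain (· ⊆ ·) T) (hT' : T.Intersecting) : IsLinearCutClass (cutsOf φ T) where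
  nonempty := by
    rintro A ⟨s, hs, rfl | hA⟩
    · exact (Finset.coe_nonempty.2 (Finset.nonempty_iff_ne_empty.2 (hT'.ne_bot hs))).image φ
    · exact ⟨r, not_not.1 (hA ▸ notMem_image_of_range_eq hr s :)⟩
  compl_mem := by
    rintro A ⟨s, hs, h | h⟩
    · exact ⟨s, hs, Or.inr (by rw [compl_compl, h])⟩
    · exact ⟨s, hs, Or.inl h⟩
  union_mem := by
    have hnested {A B : Set V} {s t : Finset X} (hs : s ∈ T) (ht : t ∈ T) (hA : A = φ '' s)
        (hB : Bᶜ = φ '' t) (hAB : Disjoint A B) : A ∪ B = univ := by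
      have hsub : φ '' (s : Set X) ⊆ φ '' t := hA ▸ hB ▸ hAB.subset_compl_right
      have hst : s = t := hT.eq hs ht (Finset.coe_subset.1 ((image_subset_image_iff hφ).1 hsub))
      rw [hA, hst, ← hB, compl_union_self]
    rintro A B ⟨s, hs, hA⟩ ⟨t, ht, hB⟩ hAB hAB'
    exfalso
    rw [nonempty_compl] at hAB'
    rcases hA with hA | hA <;> rcases hB with hB | hB
    · rw [hA, hB, disjoint_image_iff hφ, Finset.disjoint_coe] at hAB
      exact hT' hs ht hAB
    · exact hAB' (hnested hs ht hA hB hAB)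
    · exact hAB' (union_comm A B ▸ hnested ht hs hB hA hAB.symm)
    · have hrA : r ∈ A := not_not.1 (hA ▸ notMem_image_of_range_eq hr s :)
      have hrB : r ∈ B := not_not.1 (hB ▸ notMem_image_of_range_eq hr t :)
      exact disjoint_left.1 hAB hrA hrB

theorem rootedCuts_cutsOf (hφ : φ.Injective) (hr : range φ = {r}ᶜ) :
    rootedCuts φ (cutsOf φ T) = T := by
  ext s
  constructor
  · rintro ⟨t, ht, h | h⟩
    · rwa [Finset.coe_injective (hφ.image_injective h)]
    · exact (notMem_image_of_range_eq hr t (h ▸ notMem_image_of_range_eq hr s)).elim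
  · exact fun hs => ⟨s, hs, Or.inl rfl⟩

theorem intersecting_of_sized [Fintype X] [DecidableEq X] {k : ℕ} (hk : Fintype.card X < 2 * k)
    (hT : T.Sized k) : T.Intersecting := by
  intro s hs t ht hst
  have hcard := Finset.card_le_univ (s ∪ t)
  rw [Finset.card_union_of_disjoint hst, hT hs, hT ht] at hcard
  lia

theorem two_pow_choose_le_ncard_isLinearCutClass [Fintype X] [Finite V] (hφ : φ.Injective)
    (hr : range φ = {r}ᶜ) {k : ℕ} (hk : Fintype.card X < 2 * k) :
    2 ^ (Fintype.card X).choose k ≤ {F : Set (Set V) | IsLinearCutClass F}.ncard := by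
  classical
  have hlayer : (𝒫 (Finset.powersetCard k (Finset.univ : Finset X) : Set (Finset X))).ncard =
      2 ^ (Fintype.card X).choose k := by
    rw [ncard_powerset, ncard_coe_finset, Finset.card_powersetCard, Finset.card_univ]
  rw [← hlayer]
  refine ncard_le_ncard_of_injOn (cutsOf φ) (fun T hT => ?_) fun T _ T' _ h => ?_
  · have hsized : T.Sized k := fun s hs => (Finset.mem_powersetCard.1 (hT hs)).2
    exact isLinearCutClass_cutsOf hφ hr hsized.isAntichain (intersecting_of_sized hk hsized)
  · rw [← rootedCuts_cutsOf hφ hr (T := T), h, rootedCuts_cutsOf hφ hr]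

end CutsOf

section IndependentSubsets

open Finset

variable {α : Type*}

/-- The independent sets of the graph `G` contained in `A`: the objects that the container
argument counts. -/
def indepSubsets (G : SimpleGraph α) (A : Set α) : Set (Set α) :=
  {I | I ⊆ A ∧ G.IsIndepSet I}

theorem indepSubsets_subset_union (G : SimpleGraph α) (A : Set α) (v : α) :
    indepSubsets G A ⊆ indepSubsets G (A \ {v}) ∪
      insert v '' indepSubsets G ((A \ {v}) \ G.neighborSet v) := by
  rintro I ⟨hIA, hI⟩
  by_cases hv : v ∈ I
  · refine Or.inr ⟨I \ {v}, ⟨fun x hx => ⟨⟨hIA hx.1, hx.2⟩, ?_⟩, hI.mono Set.sdiff_subset⟩,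
      Set.insert_sdiff_self_of_mem hv⟩
    exact hI hv hx.1 (Ne.symm hx.2)
  · exact Or.inl ⟨Set.subset_sdiff_singleton hIA hv, hI⟩

variable [Finite α] (G : SimpleGraph α)

theorem ncard_indepSubsets_le_two_pow (A : Set α) : (indepSubsets G A).ncard ≤ 2 ^ A.ncard :=
  (Set.ncard_le_ncard fun _ hI => hI.1).trans (Set.ncard_powerset A).le

theorem ncard_indepSubsets_le_add (A : Set α) (v : α) :
    (indepSubsets G A).ncard ≤ (indepSubsets G (A \ {v})).ncard +
      (indepSubsets G ((A \ {v}) \ G.neighborSet v)).ncard :=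
  calc (indepSubsets G A).ncard
      ≤ _ := Set.ncard_le_ncard (indepSubsets_subset_union G A v)
    _ ≤ _ := Set.ncard_union_le _ _
    _ ≤ _ := Nat.add_le_add_left Set.ncard_image_le _

/- Remove vertices of degree at least `d` one at a time. Such a vertex is not in the independent
set, or it excludes `d` further vertices, which costs a factor `(1 + β) ^ d ≥ 1 / β`; hence each
removal costs a factor of at most `1 + β`. -/
theorem ncard_indepSubsets_le {d m : ℕ} {β : ℝ} (hβ : 0 ≤ β) (hβd : 1 ≤ β * (1 + β) ^ d)
    (hm : ∀ A : Set α, (∀ a ∈ A, (A ∩ G.neighborSet a).ncard < d) → A.ncard ≤ m) (A : Set α) :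
    ((indepSubsets G A).ncard : ℝ) ≤ 2 ^ m * (1 + β) ^ A.ncard := by
  have hone : 1 ≤ 1 + β := le_add_of_nonneg_right hβ
  induction A using WellFoundedLT.induction with | ind A ih => ?_
  by_cases hA : ∀ a ∈ A, (A ∩ G.neighborSet a).ncard < d
  · calc ((indepSubsets G A).ncard : ℝ) ≤ 2 ^ A.ncard := by
          exact_mod_cast ncard_indepSubsets_le_two_pow G A
      _ ≤ 2 ^ m := pow_le_pow_right₀ one_le_two (hm A hA)
      _ ≤ 2 ^ m * (1 + β) ^ A.ncard := le_mul_of_one_le_right (by positivity) (one_le_pow₀ hone)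
  push Not at hA
  obtain ⟨v, hv, hd⟩ := hA
  set B := A \ {v}
  have hBA : B ⊂ A := Set.sdiff_singleton_ssubset.2 hv
  have hB : B.ncard + 1 = A.ncard := Set.ncard_sdiff_singleton_add_one hv
  have hnbr : A ∩ G.neighborSet v ⊆ B := fun x hx => ⟨hx.1, hx.2.ne'⟩
  have hBd : (B \ G.neighborSet v).ncard + d ≤ B.ncard := by
    have hinter : A ∩ G.neighborSet v ⊆ B ∩ G.neighborSet v := Set.subset_inter hnbr
      Set.inter_subset_right
    have hsplit := Set.ncard_inter_add_ncard_sdiff_eq_ncard B (G.neighborSet v)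
    have hle := Set.ncard_le_ncard hinter
    lia
  have hpow : (1 + β) ^ (B \ G.neighborSet v).ncard ≤ β * (1 + β) ^ B.ncard :=
    calc (1 + β) ^ (B \ G.neighborSet v).ncard
        ≤ (1 + β) ^ (B \ G.neighborSet v).ncard * (β * (1 + β) ^ d) :=
          le_mul_of_one_le_right (by positivity) hβd
      _ = β * (1 + β) ^ ((B \ G.neighborSet v).ncard + d) := by ring
      _ ≤ β * (1 + β) ^ B.ncard := by gcongr
  calc ((indepSubsets G A).ncard : ℝ)
      ≤ (indepSubsets G B).ncard + (indepSubsets G (B \ G.neighborSet v)).ncard := by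
        exact_mod_cast ncard_indepSubsets_le_add G A v
    _ ≤ 2 ^ m * (1 + β) ^ B.ncard + 2 ^ m * (1 + β) ^ (B \ G.neighborSet v).ncard :=
        add_le_add (ih B hBA) (ih _ (Set.sdiff_subset.trans_ssubset hBA))
    _ ≤ 2 ^ m * (1 + β) ^ B.ncard + 2 ^ m * (β * (1 + β) ^ B.ncard) := by gcongr
    _ = 2 ^ m * (1 + β) ^ A.ncard := by rw [← hB]; ring

end IndependentSubsets

section PrefixedPairs

open Finset Numbering

variable {X : Type*} [DecidableEq X]

theorem eq_and_eq_of_swap_mem_iff {s : Finset X} {x y x' y' : X} (hx : x ∈ s) (hy : y ∉ s)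
    (hx' : x' ∈ s) (hy' : y' ∉ s) (h : ∀ z, Equiv.swap x y z ∈ s ↔ Equiv.swap x' y' z ∈ s) :
    x = x' ∧ y = y' := by
  constructor
  · by_contra hne
    have hxy' : x ≠ y' := ne_of_mem_of_not_mem hx hy'
    have hiff := h x
    rw [Equiv.swap_apply_left, Equiv.swap_apply_of_ne_of_ne hne hxy'] at hiff
    exact hy (hiff.2 hx)
  · by_contra hne
    have hyx' : y ≠ x' := (ne_of_mem_of_not_mem hx' hy).symm
    have hiff := h y
    rw [Equiv.swap_apply_right, Equiv.swap_apply_of_ne_of_ne hyx' hne] at hiff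
    exact hy (hiff.1 hx)

variable [Fintype X]

theorem swap_trans_mem_prefixed {t : Finset X} {f : Numbering X} {x y : X} (hf : f ∈ prefixed t)
    (hxy : x ∈ t ↔ y ∈ t) : (Equiv.swap x y).trans f ∈ prefixed t := by
  rw [mem_prefixed] at hf ⊢
  intro z
  have hswap : Equiv.swap x y z ∈ t ↔ z ∈ t := by
    rw [Equiv.swap_apply_def]
    split_ifs with hzx hzy
    · rw [hzx, hxy]
    · rw [hzy, hxy]
    · rfl
  rw [Equiv.trans_apply, ← hf, hswap]

/- Swapping an element of `s` with one outside `s` destroys the prefix `s`, and the two swapped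
elements can be read off from the result. -/
theorem card_mul_card_prefixed_inter_le {s t U W : Finset X} (hU : U ⊆ s) (hW : Disjoint W s)
    (ht : ∀ x ∈ U, ∀ y ∈ W, (x ∈ t ↔ y ∈ t)) :
    #U * #W * #(prefixed s ∩ prefixed t) ≤ #(prefixed t) := by
  rw [← card_product, ← card_product]
  refine card_le_card_of_injOn (fun p => (Equiv.swap p.1.1 p.1.2).trans p.2) ?_ ?_
  · rintro ⟨⟨x, y⟩, f⟩ h
    simp only [coe_product, Set.mem_prod, mem_coe, mem_inter] at h
    exact swap_trans_mem_prefixed h.2.2 (ht x h.1.1 y h.1.2)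
  · rintro ⟨⟨x, y⟩, f⟩ h ⟨⟨x', y'⟩, f'⟩ h' heq
    simp only [coe_product, Set.mem_prod, mem_coe, mem_inter, mem_prefixed] at h h'
    obtain ⟨⟨hx, hy⟩, hf, -⟩ := h
    obtain ⟨⟨hx', hy'⟩, hf', -⟩ := h'
    have hmem (z : X) : Equiv.swap x y z ∈ s ↔ Equiv.swap x' y' z ∈ s := by
      rw [hf, hf']
      exact iff_of_eq (congrArg (fun g : Numbering X => (g z : ℕ) < #s) heq)
    obtain ⟨rfl, rfl⟩ := eq_and_eq_of_swap_mem_iff (hU hx) (disjoint_left.1 hW hy) (hU hx')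
      (disjoint_left.1 hW hy') hmem
    have hff' : f = f' := by
      ext z
      simpa using congrArg (fun g : Numbering X => (g (Equiv.swap x y z) : ℕ)) heq
    rw [hff']

theorem card_sub_one_mul_card_prefixed_inter_le {s t : Finset X} (hs : s.Nonempty)
    (hst : s ⊂ t) :
    (Fintype.card X - 1) * #(prefixed s ∩ prefixed t) ≤ #(prefixed s) + #(prefixed t) := by
  have hinside : #s * #(t \ s) * #(prefixed s ∩ prefixed t) ≤ #(prefixed t) :=
    card_mul_card_prefixed_inter_le subset_rfl disjoint_sdiff_self_left fun _ hx _ hy =>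
      iff_of_true (hst.subset hx) (mem_sdiff.1 hy).1
  have houtside : #(t \ s) * #tᶜ * #(prefixed s ∩ prefixed t) ≤ #(prefixed s) := by
    rw [inter_comm]
    exact card_mul_card_prefixed_inter_le sdiff_subset disjoint_compl_left fun _ hx _ hy =>
      iff_of_false (mem_sdiff.1 hx).2 fun h => mem_compl.1 hy (hst.subset h)
  have hcard : #s + #(t \ s) + #tᶜ = Fintype.card X := by
    rw [add_comm #s, card_sdiff_add_card_eq_card hst.subset, card_add_card_compl]
  have hs_pos : 0 < #s := hs.card_pos
  have hdiff_pos : 0 < #(t \ s) := (sdiff_nonempty.2 hst.not_subset).card_pos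
  have hle : Fintype.card X - 1 ≤ #s * #(t \ s) + #(t \ s) * #tᶜ := by
    rw [Nat.sub_le_iff_le_add, ← hcard]
    nlinarith
  calc (Fintype.card X - 1) * #(prefixed s ∩ prefixed t)
      ≤ (#s * #(t \ s) + #(t \ s) * #tᶜ) * #(prefixed s ∩ prefixed t) := by gcongr
    _ ≤ #(prefixed s) + #(prefixed t) := by rw [add_mul]; lia

end PrefixedPairs

section StrictPairs

open Finset

variable {α : Type*} [Preorder α] [DecidableLT α]

/-- The strictly increasing pairs of members of `A`. -/
def ltPairs (A : Finset α) : Finset (α × α) :=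
  {p ∈ A ×ˢ A | p.1 < p.2}

theorem sum_ltPairs_add (A : Finset α) (w : α → ℕ) :
    ∑ p ∈ ltPairs A, (w p.1 + w p.2) = ∑ a ∈ A, #{b ∈ A | a < b ∨ b < a} * w a := by
  classical
  have hsplit (a : α) : #{b ∈ A | a < b ∨ b < a} = #{b ∈ A | a < b} + #{b ∈ A | b < a} := by
    rw [filter_or, card_union_of_disjoint]
    exact disjoint_filter.2 fun b _ hab hba => hab.asymm hba
  have hfst : ∑ p ∈ ltPairs A, w p.1 = ∑ a ∈ A, #{b ∈ A | a < b} * w a := by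
    rw [ltPairs, sum_filter, sum_product]
    exact sum_congr rfl fun a _ => by simp only [← sum_filter, sum_const, smul_eq_mul]
  have hsnd : ∑ p ∈ ltPairs A, w p.2 = ∑ a ∈ A, #{b ∈ A | b < a} * w a := by
    rw [ltPairs, sum_filter, sum_product_right]
    exact sum_congr rfl fun a _ => by simp only [← sum_filter, sum_const, smul_eq_mul]
  simp only [sum_add_distrib, hfst, hsnd, hsplit, add_mul]

end StrictPairs

section FewComparable

open Finset Numbering

variable {X : Type*} [DecidableEq X] [Fintype X] {A : Finset (Finset X)} {d : ℕ}

/- The sets of `A` that are prefixes of a numbering form a chain; pair its least member with each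
of the others. -/
theorem card_filter_mem_prefixed_le (A : Finset (Finset X)) (f : Numbering X) :
    #{a ∈ A | f ∈ prefixed a} ≤ #{p ∈ ltPairs A | f ∈ prefixed p.1 ∩ prefixed p.2} + 1 := by
  rcases ({a ∈ A | f ∈ prefixed a}).eq_empty_or_nonempty with hempty | hne
  · exact (card_eq_zero.2 hempty).trans_le (Nat.zero_le _)
  obtain ⟨a, ha, hmin⟩ := exists_min_image _ card hne
  rw [← card_erase_add_one ha]
  refine Nat.add_le_add_right (card_le_card_of_injOn (fun b => (a, b)) ?_ ?_) 1
  · intro b hb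
    obtain ⟨hba, hb⟩ := mem_erase.1 hb
    have hle : #a ≤ #b := hmin b hb
    rw [mem_filter] at ha hb
    have hab : a ⊆ b := (mem_prefixed.1 ha.2).subset_of_card_le_card (mem_prefixed.1 hb.2) hle
    simp only [mem_coe, mem_filter, ltPairs, mem_product, mem_inter]
    exact ⟨⟨⟨ha.1, hb.1⟩, hab.ssubset_of_ne hba.symm⟩, ha.2, hb.2⟩
  · exact fun _ _ _ _ h => (Prod.mk.inj h).2

theorem sum_card_prefixed_le (A : Finset (Finset X)) :
    ∑ a ∈ A, #(prefixed a) ≤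
      ∑ p ∈ ltPairs A, #(prefixed p.1 ∩ prefixed p.2) + (Fintype.card X).factorial := by
  have hcount {ι : Type _} (I : Finset ι) (g : ι → Finset (Numbering X)) :
      ∑ i ∈ I, #(g i) = ∑ f, #{i ∈ I | f ∈ g i} := by
    simpa [bipartiteAbove, bipartiteBelow] using
      sum_card_bipartiteAbove_eq_sum_card_bipartiteBelow (s := I) (t := univ) fun i f => f ∈ g i
  calc ∑ a ∈ A, #(prefixed a) = ∑ f, #{a ∈ A | f ∈ prefixed a} := hcount A _
    _ ≤ ∑ f, (#{p ∈ ltPairs A | f ∈ prefixed p.1 ∩ prefixed p.2} + 1) :=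
        sum_le_sum fun f _ => card_filter_mem_prefixed_le A f
    _ = _ := by
        rw [sum_add_distrib, ← hcount, sum_const, smul_eq_mul, mul_one, card_univ,
          Fintype.card_numbering]

theorem card_mul_factorial_le (A : Finset (Finset X)) :
    #A * (Fintype.card X).factorial ≤
      (Fintype.card X).choose (Fintype.card X / 2) * ∑ a ∈ A, #(prefixed a) := by
  rw [mul_sum, ← smul_eq_mul]
  refine card_nsmul_le_sum A _ _ fun a _ => ?_
  rw [card_prefixed, ← Nat.choose_mul_factorial_mul_factorial (card_le_univ a), mul_assoc]
  gcongr
  exact Nat.choose_le_middle _ _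

theorem card_sub_one_mul_sum_inter_le (hA : ∅ ∉ A)
    (hd : ∀ a ∈ A, #{b ∈ A | a < b ∨ b < a} ≤ d) :
    (Fintype.card X - 1) * ∑ p ∈ ltPairs A, #(prefixed p.1 ∩ prefixed p.2) ≤
      d * ∑ a ∈ A, #(prefixed a) :=
  calc (Fintype.card X - 1) * ∑ p ∈ ltPairs A, #(prefixed p.1 ∩ prefixed p.2)
      ≤ ∑ p ∈ ltPairs A, (#(prefixed p.1) + #(prefixed p.2)) := by
        rw [mul_sum]
        refine sum_le_sum fun p hp => ?_
        rw [ltPairs, mem_filter, mem_product] at hp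
        have hne : p.1.Nonempty := nonempty_iff_ne_empty.2 (ne_of_mem_of_not_mem hp.1.1 hA)
        exact card_sub_one_mul_card_prefixed_inter_le hne hp.2
    _ = ∑ a ∈ A, #{b ∈ A | a < b ∨ b < a} * #(prefixed a) :=
        sum_ltPairs_add A fun a => #(prefixed a)
    _ ≤ ∑ a ∈ A, d * #(prefixed a) := by gcongr with a ha; exact hd a ha
    _ = d * ∑ a ∈ A, #(prefixed a) := (mul_sum ..).symm

theorem card_mul_le_of_card_comparable_le (hA : ∅ ∉ A)
    (hd : ∀ a ∈ A, #{b ∈ A | a < b ∨ b < a} ≤ d) :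
    #A * (Fintype.card X - 1 - d) ≤
      (Fintype.card X).choose (Fintype.card X / 2) * (Fintype.card X - 1) := by
  set N := Fintype.card X - 1
  set C := (Fintype.card X).choose (Fintype.card X / 2)
  set S := ∑ a ∈ A, #(prefixed a)
  set P := ∑ p ∈ ltPairs A, #(prefixed p.1 ∩ prefixed p.2)
  have hsum : (N - d) * S ≤ N * (Fintype.card X).factorial := by
    rw [Nat.sub_mul, Nat.sub_le_iff_le_add]
    calc N * S ≤ N * (P + (Fintype.card X).factorial) :=
          Nat.mul_le_mul_left _ (sum_card_prefixed_le A)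
      _ = N * (Fintype.card X).factorial + N * P := by ring
      _ ≤ N * (Fintype.card X).factorial + d * S :=
          Nat.add_le_add_left (card_sub_one_mul_sum_inter_le hA hd) _
  refine Nat.le_of_mul_le_mul_right ?_ (Fintype.card X).factorial_pos
  calc #A * (N - d) * (Fintype.card X).factorial
      = #A * (Fintype.card X).factorial * (N - d) := by ring
    _ ≤ C * S * (N - d) :=
        Nat.mul_le_mul_right _ (card_mul_factorial_le A)
    _ = C * ((N - d) * S) := by ring
    _ ≤ C * (N * (Fintype.card X).factorial) := by gcongr
    _ = C * N * (Fintype.card X).factorial := by ring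

end FewComparable

section CountingAntichains

open Finset

theorem isIndepSet_fromRel_lt_iff {α : Type*} [PartialOrder α] {s : Set α} :
    (SimpleGraph.fromRel (V := α) (· < ·)).IsIndepSet s ↔ IsAntichain (· ≤ ·) s := by
  refine ⟨fun h a ha b hb hab hle => ?_, fun h a ha b hb hab hadj => ?_⟩
  · exact h ha hb hab ⟨hab, Or.inl (hle.lt_of_ne hab)⟩
  · rcases hadj.2 with hlt | hlt
    · exact h ha hb hab hlt.le
    · exact h hb ha hab.symm hlt.le

variable {X : Type*} [Fintype X] {d m : ℕ} {β : ℝ}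

theorem ncard_isAntichain_le (hβ : 0 ≤ β) (hβd : 1 ≤ β * (1 + β) ^ d)
    (hd : d < Fintype.card X - 1)
    (hm : (Fintype.card X).choose (Fintype.card X / 2) * (Fintype.card X - 1) ≤
      m * (Fintype.card X - 1 - d)) :
    ({𝒜 : Set (Finset X) | IsAntichain (· ⊆ ·) 𝒜}.ncard : ℝ) ≤
      2 ^ (m + 1) * (1 + β) ^ 2 ^ Fintype.card X := by
  classical
  let G : SimpleGraph (Finset X) := SimpleGraph.fromRel (· < ·)
  have hantichain : {𝒜 : Set (Finset X) | IsAntichain (· ⊆ ·) 𝒜} = indepSubsets G Set.univ :=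
    Set.ext fun 𝒜 => isIndepSet_fromRel_lt_iff.symm.trans (and_iff_right (Set.subset_univ 𝒜)).symm
  have hmax (A : Set (Finset X)) (hA : ∀ a ∈ A, (A ∩ G.neighborSet a).ncard < d) :
      A.ncard ≤ m + 1 := by
    lift A to Finset (Finset X) using A.toFinite
    have hdeg (a) (ha : a ∈ A.erase ∅) : #{b ∈ A.erase ∅ | a < b ∨ b < a} ≤ d := by
      refine le_trans ?_ (hA a (mem_coe.2 (mem_of_mem_erase ha))).le
      rw [← Set.ncard_coe_finset]
      refine Set.ncard_le_ncard fun b hb => ?_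
      obtain ⟨hbA, hab⟩ := mem_filter.1 (mem_coe.1 hb)
      exact ⟨mem_of_mem_erase hbA, hab.elim ne_of_lt ne_of_gt, hab⟩
    have hle := (card_mul_le_of_card_comparable_le (notMem_erase ∅ A) hdeg).trans hm
    have hle' : #(A.erase ∅) ≤ m := Nat.le_of_mul_le_mul_right hle (Nat.sub_pos_of_lt hd)
    rw [Set.ncard_coe_finset]
    have := pred_card_le_card_erase (s := A) (a := ∅)
    lia
  have hcard : (Set.univ : Set (Finset X)).ncard = 2 ^ Fintype.card X := by
    rw [Set.ncard_univ, Nat.card_eq_fintype_card, Fintype.card_finset]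
  rw [hantichain, ← hcard]
  exact ncard_indepSubsets_le G hβ hβd hmax Set.univ

end CountingAntichains

section MiddleBinomial

open Filter Topology Real

theorem sixteen_pow_le_centralBinom_sq_mul (m : ℕ) : 16 ^ m ≤ m.centralBinom ^ 2 * (4 * m + 1) := by
  induction m with
  | zero => simp
  | succ m ih =>
    refine Nat.le_of_mul_le_mul_left ?_ (Nat.pow_pos m.succ_pos : 0 < (m + 1) ^ 2)
    calc (m + 1) ^ 2 * 16 ^ (m + 1) = 16 * (m + 1) ^ 2 * 16 ^ m := by ring
      _ ≤ 16 * (m + 1) ^ 2 * (m.centralBinom ^ 2 * (4 * m + 1)) := by gcongr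
      _ ≤ (2 * (2 * m + 1) * m.centralBinom) ^ 2 * (4 * (m + 1) + 1) := by
        nlinarith [sq_nonneg m.centralBinom]
      _ = ((m + 1) * (m + 1).centralBinom) ^ 2 * (4 * (m + 1) + 1) := by
        rw [Nat.succ_mul_centralBinom_succ]
      _ = (m + 1) ^ 2 * ((m + 1).centralBinom ^ 2 * (4 * (m + 1) + 1)) := by ring

theorem centralBinom_succ_eq_two_mul_choose (m : ℕ) :
    (m + 1).centralBinom = 2 * (2 * m + 1).choose m := by
  rw [Nat.centralBinom_eq_two_mul_choose, Nat.mul_succ, Nat.choose_succ_succ, Nat.choose_symm_half]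
  ring

theorem four_pow_le_choose_middle_sq_mul (n : ℕ) :
    4 ^ n ≤ n.choose (n / 2) ^ 2 * (2 * n + 3) := by
  rcases Nat.even_or_odd' n with ⟨m, rfl | rfl⟩
  · have hdiv : 2 * m / 2 = m := by lia
    rw [hdiv, ← Nat.centralBinom_eq_two_mul_choose, pow_mul]
    refine (sixteen_pow_le_centralBinom_sq_mul m).trans ?_
    exact Nat.mul_le_mul_left _ (by lia)
  · have hdiv : (2 * m + 1) / 2 = m := by lia
    have h := sixteen_pow_le_centralBinom_sq_mul (m + 1)
    rw [centralBinom_succ_eq_two_mul_choose] at h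
    have hpow : 16 ^ (m + 1) = 4 * 4 ^ (2 * m + 1) := by
      rw [← pow_succ', show (16 : ℕ) = 4 ^ 2 by norm_num, ← pow_mul]
      ring
    rw [hdiv]
    lia

theorem two_pow_le_choose_middle_mul_sqrt (n : ℕ) :
    (2 : ℝ) ^ n ≤ n.choose (n / 2) * √(2 * n + 3) := by
  have hsq : ((2 : ℝ) ^ n) ^ 2 ≤ (n.choose (n / 2) * √(2 * n + 3)) ^ 2 := by
    rw [mul_pow, sq_sqrt (by positivity), ← pow_mul, mul_comm n, pow_mul]
    exact_mod_cast four_pow_le_choose_middle_sq_mul n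
  exact le_of_sq_le_sq hsq (by positivity)

theorem choose_middle_mul_le_choose_middle_succ (n : ℕ) :
    (n.choose (n / 2) : ℝ) * (1 - 2 / (n + 2)) ≤ n.choose (n / 2 + 1) := by
  have hratio : (n.choose (n / 2 + 1) : ℝ) * ((n / 2 : ℕ) + 1) =
      n.choose (n / 2) * ((n : ℝ) - (n / 2 : ℕ)) := by
    rw [← Nat.cast_sub (Nat.div_le_self n 2)]
    exact_mod_cast Nat.choose_succ_right_eq n (n / 2)
  have hhalf : ((n / 2 : ℕ) : ℝ) ≤ n / 2 := Nat.cast_div_le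
  have hle : (1 - 2 / (n + 2) : ℝ) ≤ ((n : ℝ) - (n / 2 : ℕ)) / ((n / 2 : ℕ) + 1) := by
    have hn : (0 : ℝ) < n + 2 := by positivity
    rw [one_sub_div hn.ne', div_le_div_iff₀ hn (by positivity)]
    nlinarith
  calc (n.choose (n / 2) : ℝ) * (1 - 2 / (n + 2))
      ≤ n.choose (n / 2) * (((n : ℝ) - (n / 2 : ℕ)) / ((n / 2 : ℕ) + 1)) := by gcongr
    _ = n.choose (n / 2 + 1) := by
      rw [← mul_div_assoc, ← hratio, mul_div_cancel_right₀ _ (by positivity)]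

theorem choose_middle_pos (n : ℕ) : (0 : ℝ) < n.choose (n / 2) :=
  Nat.cast_pos.2 (Nat.choose_pos (Nat.div_le_self n 2))

theorem tendsto_choose_middle_atTop :
    Tendsto (fun n : ℕ => (n.choose (n / 2) : ℝ)) atTop atTop := by
  refine tendsto_natCast_atTop_atTop.comp (tendsto_atTop_mono (fun n => ?_) tendsto_id)
  simpa using Nat.choose_le_middle 1 n

end MiddleBinomial

section ContainerParameters

open Filter Topology Real

theorem one_le_inv_pow_three_mul {s : ℝ} (hs : 0 < s) {k : ℕ} (hk : s ^ 4 ≤ k) :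
    1 ≤ (s ^ 3)⁻¹ * (1 + (s ^ 3)⁻¹) ^ (3 * k) := by
  have hbernoulli : s ≤ (1 + (s ^ 3)⁻¹) ^ k :=
    calc s = s ^ 4 * (s ^ 3)⁻¹ := by field_simp
      _ ≤ k * (s ^ 3)⁻¹ := by gcongr
      _ ≤ 1 + k * (s ^ 3)⁻¹ := by simp
      _ ≤ (1 + (s ^ 3)⁻¹) ^ k :=
        one_add_mul_le_pow (le_trans (by norm_num) (by positivity : 0 ≤ (s ^ 3)⁻¹)) k
  calc 1 = (s ^ 3)⁻¹ * s ^ 3 := by field_simp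
    _ ≤ (s ^ 3)⁻¹ * ((1 + (s ^ 3)⁻¹) ^ k) ^ 3 := by gcongr
    _ = (s ^ 3)⁻¹ * (1 + (s ^ 3)⁻¹) ^ (3 * k) := by rw [← pow_mul, mul_comm 3]

/-- The scale `s ≈ n ^ (1 / 5)` of the container argument, which is run with `β = s⁻³` and degree
bound `3 * s ^ 4`. Any exponent strictly between `1 / 6` and `1 / 4` would do: `s ^ 4` has to be
small compared to `n`, and `s ^ 3` large compared to `√n`. -/
def containerScale (n : ℕ) : ℕ :=
  Nat.nthRoot 5 n + 1

theorem lt_containerScale_pow_five (n : ℕ) : n < containerScale n ^ 5 :=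
  Nat.lt_pow_nthRoot_add_one (by norm_num) n

theorem containerScale_pow_five_le {n : ℕ} (hn : n ≠ 0) : containerScale n ^ 5 ≤ 32 * n := by
  have hroot : 1 ≤ Nat.nthRoot 5 n :=
    (Nat.le_nthRoot_iff (by norm_num)).2 (by simpa [Nat.one_le_iff_ne_zero] using hn)
  calc containerScale n ^ 5 ≤ (2 * Nat.nthRoot 5 n) ^ 5 := by
        rw [containerScale]
        gcongr
        lia
    _ = 32 * Nat.nthRoot 5 n ^ 5 := by ring
    _ ≤ 32 * n := by
        gcongr
        exact Nat.pow_nthRoot_le (Or.inl (by norm_num))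

theorem tendsto_containerScale_atTop :
    Tendsto (fun n => (containerScale n : ℝ)) atTop atTop := by
  refine tendsto_natCast_atTop_atTop.comp (tendsto_atTop.2 fun b => ?_)
  filter_upwards [eventually_ge_atTop (b ^ 5)] with n hn
  exact (lt_of_pow_lt_pow_left₀ 5 (Nat.zero_le _) (hn.trans_lt (lt_containerScale_pow_five n))).le

theorem tendsto_containerScale_pow_four_div :
    Tendsto (fun n : ℕ => (containerScale n : ℝ) ^ 4 / ((n : ℝ) - 1)) atTop (𝓝 0) := by
  have hlim : Tendsto (fun n => 64 / (containerScale n : ℝ)) atTop (𝓝 0) :=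
    tendsto_containerScale_atTop.const_div_atTop 64
  refine squeeze_zero' ?_ ?_ hlim
  · filter_upwards [eventually_ge_atTop 1] with n hn
    have hn' : (1 : ℝ) ≤ n := by exact_mod_cast hn
    exact div_nonneg (by positivity) (sub_nonneg.2 hn')
  · filter_upwards [eventually_ge_atTop 2] with n hn
    have hn' : (2 : ℝ) ≤ n := by exact_mod_cast hn
    have hs : (0 : ℝ) < containerScale n := Nat.cast_pos.2 (Nat.succ_pos _)
    have hpow : (containerScale n : ℝ) ^ 5 ≤ 32 * n := by
      exact_mod_cast containerScale_pow_five_le (by lia)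
    rw [div_le_div_iff₀ (by linarith) hs, ← pow_succ]
    norm_num only
    linarith

theorem tendsto_two_pow_div_containerScale_pow_three :
    Tendsto (fun n : ℕ => ((containerScale n : ℝ) ^ 3)⁻¹ * 2 ^ n / n.choose (n / 2)) atTop
      (𝓝 0) := by
  have hlim : Tendsto (fun n => √(3 / containerScale n)) atTop (𝓝 0) := by
    simpa using (tendsto_containerScale_atTop.const_div_atTop 3).sqrt
  refine squeeze_zero (fun n => by positivity) (fun n => ?_) hlim
  have hs : (0 : ℝ) < containerScale n := Nat.cast_pos.2 (Nat.succ_pos _)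
  have hn : 2 * (n : ℝ) + 3 ≤ 3 * (containerScale n : ℝ) ^ 5 := by
    have hlt := lt_containerScale_pow_five n
    exact_mod_cast (by lia : 2 * n + 3 ≤ 3 * containerScale n ^ 5)
  have hsqrt : √(2 * n + 3) ≤ (containerScale n : ℝ) ^ 3 * √(3 / containerScale n) := by
    rw [sqrt_le_left (by positivity), mul_pow, sq_sqrt (by positivity)]
    refine hn.trans_eq ?_
    field_simp
  rw [div_le_iff₀ (choose_middle_pos n), inv_mul_le_iff₀ (by positivity)]
  calc (2 : ℝ) ^ n ≤ n.choose (n / 2) * √(2 * n + 3) := two_pow_le_choose_middle_mul_sqrt n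
    _ ≤ n.choose (n / 2) * ((containerScale n : ℝ) ^ 3 * √(3 / containerScale n)) := by gcongr
    _ = _ := by ring

end ContainerParameters

section Kleitman

open Filter Topology Real

theorem logb_two_one_add_le {x : ℝ} (hx : 0 ≤ x) : logb 2 (1 + x) ≤ 2 * x := by
  rw [logb, div_le_iff₀ (log_pos one_lt_two)]
  have hlog : log (1 + x) ≤ x := by linarith [log_le_sub_one_of_pos (x := 1 + x) (by positivity)]
  nlinarith [log_two_gt_d9]

theorem natCast_le_logb_two_of_two_pow_le {k m : ℕ} (h : 2 ^ k ≤ m) : (k : ℝ) ≤ logb 2 m := by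
  have hm : (0 : ℝ) < m := Nat.cast_pos.2 ((Nat.two_pow_pos k).trans_le h)
  rw [le_logb_iff_rpow_le one_lt_two hm, rpow_natCast]
  exact_mod_cast h

theorem two_pow_choose_le_ncard_isAntichain (X : Type*) [Fintype X] (k : ℕ) :
    2 ^ (Fintype.card X).choose k ≤ {𝒜 : Set (Finset X) | IsAntichain (· ⊆ ·) 𝒜}.ncard := by
  rw [← Finset.card_univ, ← Finset.card_powersetCard, ← Set.ncard_coe_finset, ← Set.ncard_powerset]
  refine Set.ncard_le_ncard fun 𝒜 h𝒜 => ?_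
  have hsized : 𝒜.Sized k := fun s hs => (Finset.mem_powersetCard.1 (h𝒜 hs)).2
  exact hsized.isAntichain

theorem logb_two_le_of_le_two_pow_mul {c β : ℝ} {m N : ℕ} (hc : 0 < c) (hβ : 0 ≤ β)
    (h : c ≤ 2 ^ m * (1 + β) ^ N) : logb 2 c ≤ m + 2 * (β * N) :=
  calc logb 2 c ≤ logb 2 (2 ^ m * (1 + β) ^ N) := logb_le_logb_of_le one_lt_two hc h
    _ = m + N * logb 2 (1 + β) := by
      rw [logb_mul (by positivity) (by positivity), logb_pow, logb_pow,
        logb_self_eq_one one_lt_two, mul_one]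
    _ ≤ m + N * (2 * β) := by gcongr; exact logb_two_one_add_le hβ
    _ = m + 2 * (β * N) := by ring

theorem logb_ncard_isAntichain_le {n s : ℕ} (hs : s ≠ 0) (hd : 3 * s ^ 4 < n - 1) :
    logb 2 {𝒜 : Set (Finset (Fin n)) | IsAntichain (· ⊆ ·) 𝒜}.ncard ≤
      n.choose (n / 2) / (1 - 3 * (s ^ 4 / ((n : ℝ) - 1))) + 2 + 2 * ((s ^ 3 : ℝ)⁻¹ * 2 ^ n) := by
  have hn : ((n - 1 : ℕ) : ℝ) = n - 1 := Nat.cast_pred (by lia)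
  have hn_pos : (0 : ℝ) < n - 1 := hn ▸ Nat.cast_pos.2 (by lia)
  have hsub : ((n - 1 - 3 * s ^ 4 : ℕ) : ℝ) = (n - 1) * (1 - 3 * (s ^ 4 / (n - 1))) := by
    rw [Nat.cast_sub hd.le, hn]
    push_cast
    field_simp
  have hgap : (0 : ℝ) < 1 - 3 * (s ^ 4 / ((n : ℝ) - 1)) :=
    pos_of_mul_pos_right (hsub ▸ Nat.cast_pos.2 (Nat.sub_pos_of_lt hd)) hn_pos.le
  set M : ℝ := n.choose (n / 2) / (1 - 3 * (s ^ 4 / ((n : ℝ) - 1)))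
  have hm : n.choose (n / 2) * (n - 1) ≤ ⌈M⌉₊ * (n - 1 - 3 * s ^ 4) := by
    have hceil : (n.choose (n / 2) : ℝ) ≤ ⌈M⌉₊ * (1 - 3 * (s ^ 4 / ((n : ℝ) - 1))) :=
      (div_le_iff₀ hgap).1 (Nat.le_ceil M)
    rw [← Nat.cast_le (α := ℝ), Nat.cast_mul, Nat.cast_mul, hsub, hn]
    nlinarith
  have hs' : (0 : ℝ) < s := Nat.cast_pos.2 (Nat.pos_of_ne_zero hs)
  have hs4 : (s : ℝ) ^ 4 ≤ (s ^ 4 : ℕ) := (Nat.cast_pow s 4).ge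
  have hcount := ncard_isAntichain_le (X := Fin n) (by positivity)
    (one_le_inv_pow_three_mul hs' hs4) (by simpa using hd) (by simpa using hm)
  have hpos : 0 < {𝒜 : Set (Finset (Fin n)) | IsAntichain (· ⊆ ·) 𝒜}.ncard :=
    (Nat.two_pow_pos _).trans_le (two_pow_choose_le_ncard_isAntichain (Fin n) 0)
  have hlog := logb_two_le_of_le_two_pow_mul (Nat.cast_pos.2 hpos) (by positivity) hcount
  rw [Fintype.card_fin] at hlog
  push_cast at hlog
  have hM : (⌈M⌉₊ : ℝ) < M + 1 := Nat.ceil_lt_add_one (by positivity)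
  linarith

theorem eventually_logb_ncard_isAntichain_div_choose_le :
    ∀ᶠ n : ℕ in atTop,
      logb 2 {𝒜 : Set (Finset (Fin n)) | IsAntichain (· ⊆ ·) 𝒜}.ncard / n.choose (n / 2) ≤
        1 / (1 - 3 * (containerScale n ^ 4 / ((n : ℝ) - 1))) + 2 / n.choose (n / 2) +
          2 * (((containerScale n : ℝ) ^ 3)⁻¹ * 2 ^ n / n.choose (n / 2)) := by
  have hsmall : ∀ᶠ n : ℕ in atTop, (containerScale n : ℝ) ^ 4 / ((n : ℝ) - 1) < 1 / 3 :=
    tendsto_containerScale_pow_four_div.eventually_lt_const (by norm_num)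
  filter_upwards [hsmall, eventually_ge_atTop 2] with n hn hn2
  have hd : 3 * containerScale n ^ 4 < n - 1 := by
    rw [div_lt_iff₀ (by have : (2 : ℝ) ≤ n := by exact_mod_cast hn2
                        linarith)] at hn
    rw [← Nat.cast_lt (α := ℝ), Nat.cast_pred (by lia)]
    push_cast
    linarith
  have hC := choose_middle_pos n
  rw [div_le_iff₀ hC]
  refine (logb_ncard_isAntichain_le (s := containerScale n) (Nat.succ_ne_zero _) hd).trans_eq ?_
  field_simp

theorem tendsto_logb_ncard_isAntichain_div_choose :
    Tendsto (fun n : ℕ =>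
      logb 2 {𝒜 : Set (Finset (Fin n)) | IsAntichain (· ⊆ ·) 𝒜}.ncard / n.choose (n / 2))
      atTop (𝓝 1) := by
  have hupper : Tendsto (fun n : ℕ => 1 / (1 - 3 * (containerScale n ^ 4 / ((n : ℝ) - 1))) +
      2 / n.choose (n / 2) + 2 * (((containerScale n : ℝ) ^ 3)⁻¹ * 2 ^ n / n.choose (n / 2)))
      atTop (𝓝 (1 / (1 - 3 * 0) + 0 + 2 * 0)) :=
    ((tendsto_const_nhds.div ((tendsto_containerScale_pow_four_div.const_mul 3).const_sub 1)
      (by norm_num)).add (tendsto_choose_middle_atTop.const_div_atTop 2)).add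
        (tendsto_two_pow_div_containerScale_pow_three.const_mul 2)
  norm_num only at hupper
  refine tendsto_of_tendsto_of_tendsto_of_le_of_le' tendsto_const_nhds hupper
    (Eventually.of_forall fun n => ?_) eventually_logb_ncard_isAntichain_div_choose_le
  have hcount := two_pow_choose_le_ncard_isAntichain (Fin n) (n / 2)
  rw [Fintype.card_fin] at hcount
  exact (one_le_div (choose_middle_pos n)).2 (natCast_le_logb_two_of_two_pow_le hcount)

end Kleitman

section Asymptotics

open Filter Topology Real

theorem two_pow_choose_le_ncard_extensions (n : ℕ) :
    2 ^ n.choose (n / 2 + 1) ≤ (extensions (cliqueMatroid (Fin (n + 1)))).ncard := by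
  have hbound := two_pow_choose_le_ncard_isLinearCutClass (Fin.succ_injective n)
    (Fin.range_succ n) (k := n / 2 + 1) (by rw [Fintype.card_fin]; lia)
  rwa [Fintype.card_fin, ← ncard_extensions_cliqueMatroid] at hbound

theorem ncard_extensions_le_ncard_isAntichain (n : ℕ) :
    (extensions (cliqueMatroid (Fin (n + 1)))).ncard ≤
      {𝒜 : Set (Finset (Fin n)) | IsAntichain (· ⊆ ·) 𝒜}.ncard := by
  rw [ncard_extensions_cliqueMatroid]
  exact ncard_isLinearCutClass_le (Fin.succ_injective n) (Fin.range_succ n)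

theorem ncard_extensions_pos (n : ℕ) :
    (0 : ℝ) < (extensions (cliqueMatroid (Fin (n + 1)))).ncard :=
  Nat.cast_pos.2 ((Nat.two_pow_pos _).trans_le (two_pow_choose_le_ncard_extensions n))

theorem tendsto_logb_ncard_extensions_div_choose :
    Tendsto (fun n : ℕ =>
      logb 2 (extensions (cliqueMatroid (Fin (n + 1)))).ncard / n.choose (n / 2)) atTop (𝓝 1) := by
  have hlower : Tendsto (fun n : ℕ => 1 - 2 / ((n : ℝ) + 2)) atTop (𝓝 1) := by
    simpa using (tendsto_atTop_add_const_right _ (2 : ℝ)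
      tendsto_natCast_atTop_atTop).const_div_atTop 2 |>.const_sub 1
  refine tendsto_of_tendsto_of_tendsto_of_le_of_le hlower
    tendsto_logb_ncard_isAntichain_div_choose (fun n => ?_) fun n => ?_
  · dsimp only
    rw [le_div_iff₀' (choose_middle_pos n)]
    exact (choose_middle_mul_le_choose_middle_succ n).trans
      (natCast_le_logb_two_of_two_pow_le (two_pow_choose_le_ncard_extensions n))
  · dsimp only
    gcongr
    · exact one_lt_two
    · exact ncard_extensions_pos n
    · exact ncard_extensions_le_ncard_isAntichain n

end Asymptotics

end CliqueExt


theorem theorem1 :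
    ∃ ε : ℕ → ℝ, Filter.Tendsto ε Filter.atTop (nhds 0) ∧
      ∀ n : ℕ,
        ((CliqueExt.extensions
            (CliqueExt.cycleMatroid (⊤ : SimpleGraph (Fin (n + 1))))).ncard : ℝ) =
          (2 : ℝ) ^ ((n.choose (n / 2) : ℝ) * (1 + ε n)) := by
  refine ⟨fun n => Real.logb 2 (CliqueExt.extensions (CliqueExt.cliqueMatroid (Fin (n + 1)))).ncard
    / n.choose (n / 2) - 1, ?_, fun n => ?_⟩
  · simpa using CliqueExt.tendsto_logb_ncard_extensions_div_choose.sub_const 1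
  · rw [add_sub_cancel, mul_div_cancel₀ _ (CliqueExt.choose_middle_pos n).ne',
      Real.rpow_logb two_pos (by norm_num) (CliqueExt.ncard_extensions_pos n)]
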